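/- Let $A$ be a semilattice of (not necessarily abelian) groups, i.e. an inverse semigroup with $aa^{-1}=a^{-1}a$ for all $a\in A$, and let $G$ be a group. An extension of $A$ by $G$ is a diagram $A\xrightarrow{i}U\xrightarrow{j}G$, where $U$ is an inverse semigroup, $i$ is an injective homomorphism, $j$ is a surjective homomorphism and $i(A)=j^{-1}(1)$. Two extensions $A\xrightarrow{i}U\xrightarrow{j}G$ and $A\xrightarrow{i'}U'\xrightarrow{j'}G$ are equivalent if there is an isomorphism $\mu:U\to U'$ with $\mu\circ i=i'$ and $j'\circ\mu=j$. A refinement of $A\xrightarrow{i}U\xrightarrow{j}G$ is a factorization $j=\kappa\circ\pi$ with surjective homomorphisms $\pi:U\to S$ and $\kappa:S\to G$, where $S$ is an inverse semigroup, $\pi$ is idempotent-separating and $i(A)=\pi^{-1}(E(S))$. An order-preserving transversal of $\pi$ is a map $\rho:S\to U$ with $\pi\circ\rho=\mathrm{id}_S$ and $\rho(E(S))\subseteq E(U)$ which preserves the natural partial order. An extension is admissible if it has a refinement whose $\pi$ admits an order-preserving transversal. Let $\Sigma(A)$ be the monoid, under composition of partial maps, of isomorphisms between two-sided ideals of $A$.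 A multiplier $m$ of a semigroup $I$ is a pair of maps $s\mapsto ms$, $s\mapsto sm$ of $I$ into itself such that $m(st)=(ms)t$, $(st)m=s(tm)$ and $s(mt)=(sm)t$; the multipliers of $I$ form a monoid $\mathcal M(I)$ under composition. For $\varphi,\psi\in\Sigma(A)$ write $\psi\sim\varphi$ if $\varphi,\psi$ have the same domain and the same range, and there is an invertible $m\in\mathcal M(\operatorname{ran}\varphi)$ with $\psi(s)=m\varphi(s)m^{-1}$ for all $s\in\operatorname{dom}\varphi$. This is a congruence; put $\varsigma(A)=\Sigma(A)/{\sim}$. Given a refinement and an order-preserving transversal $\rho$ of $\pi$, put $\alpha(e)=i^{-1}(\rho(e))$ for $e\in E(S)$, and for $g\in G$ let $\mathcal D_g=\{b\in A: bb^{-1}=\alpha(ss^{-1})\text{ for some }s\in\kappa^{-1}(g)\}$ and $\theta_g:\mathcal D_{g^{-1}}\to\mathcal D_g$, $\theta_g(a)=i^{-1}(\rho(s)i(a)\rho(s)^{-1})$, where $s\in\kappa^{-1}(g)$ and $\alpha(s^{-1}s)=aa^{-1}$. Then $\theta_g\in\Sigma(A)$, and the map $\psi:G\to\varsigma(A)$,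 $g\mapsto[\theta_g]$, is called the abstract kernel of the extension defined by the refinement and $\rho$. **Proposition.** Let $A\xrightarrow{i}U\xrightarrow{j}G$ and $A\xrightarrow{i'}U'\xrightarrow{j'}G$ be equivalent admissible extensions. Then they define the same abstract kernel. That is, there is a map $\psi:G\to\varsigma(A)$ which is a unital partial homomorphism, meaning that $\psi(1)=1$ and, for all $g,h\in G$, $\psi(g^{-1})\psi(g)\psi(h)=\psi(g^{-1})\psi(gh)$ and $\psi(g)\psi(h)\psi(h^{-1})=\psi(gh)\psi(h^{-1})$, such that for either extension every choice of a refinement and of an order-preserving transversal defines the abstract kernel $\psi$. -/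

import Mathlib

namespace PartialExt

universe u v w x y

/-! ### Inverse semigroups and semilattices of groups -/

/-- An inverse semigroup: every `a` has a unique (generalized) inverse `a⁻¹`. -/
class InverseSemigroup (S : Type u) extends Semigroup S, Inv S where
  mul_inv_mul : ∀ a : S, a * a⁻¹ * a = a
  inv_mul_inv : ∀ a : S, a⁻¹ * a * a⁻¹ = a⁻¹
  inv_unique : ∀ a b : S, a * b * a = a → b * a * b = b → b = a⁻¹

/-- A semilattice of (not necessarily abelian) groups, that is, an inverse semigroup `A` which is
the disjoint union of its maximal subgroups `A_e = {a | a * a⁻¹ = e = a⁻¹ * a}`, where `e` runs over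
the semilattice of idempotents of `A`. -/
class IsSemilatticeOfGroups (A : Type u) [InverseSemigroup A] : Prop where
  mul_inv_eq_inv_mul : ∀ a : A, a * a⁻¹ = a⁻¹ * a

/-- The natural partial order of an inverse semigroup: `s ≤ t` if and only if `s = e * t` for some
idempotent `e`. -/
def NatLE {S : Type u} [InverseSemigroup S] (s t : S) : Prop :=
  ∃ e : S, IsIdempotentElem e ∧ s = e * t

/-! ### Multipliers -/

/-- A multiplier `m` of a semigroup `S`: `left s` is `m s` and `right s` is `s m`. -/
@[ext]
structure Multiplier (S : Type u) [Mul S] where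
  left : S → S
  right : S → S
  left_mul : ∀ s t : S, left (s * t) = left s * t
  mul_right : ∀ s t : S, right (s * t) = s * right t
  mul_left : ∀ s t : S, s * left t = right s * t

namespace Multiplier

variable {S : Type u} [Mul S]

/-- Multipliers form a monoid: `(m n) s = m (n s)` and `s (m n) = (s m) n`. -/
instance : Monoid (Multiplier S) where
  mul m n :=
    { left := fun s => m.left (n.left s)
      right := fun s => n.right (m.right s)
      left_mul := fun s t => by rw [n.left_mul, m.left_mul]
      mul_right := fun s t => by rw [m.mul_right, n.mul_right]
      mul_left := fun s t => by rw [m.mul_left, n.mul_left] }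
  one :=
    { left := fun s => s
      right := fun s => s
      left_mul := fun _ _ => rfl
      mul_right := fun _ _ => rfl
      mul_left := fun _ _ => rfl }
  mul_assoc _ _ _ := rfl
  one_mul _ := rfl
  mul_one _ := rfl

theorem mul_left_apply (m n : Multiplier S) (s : S) : (m * n).left s = m.left (n.left s) := rfl

theorem mul_right_apply (m n : Multiplier S) (s : S) : (m * n).right s = n.right (m.right s) := rfl

theorem one_left_apply (s : S) : (1 : Multiplier S).left s = s := rfl

theorem one_right_apply (s : S) : (1 : Multiplier S).right s = s := rfl

/-- The conjugation `s ↦ m s m⁻¹` by an invertible multiplier `m`. -/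
def conj (m : (Multiplier S)ˣ) (s : S) : S :=
  (m⁻¹ : (Multiplier S)ˣ).val.right (m.val.left s)

/-- The multiplier `m ^ α` of `T` obtained from a multiplier `m` of `S` along `α : S ≃* T`. -/
def transfer {T : Type v} [Mul T] (α : S ≃* T) : Multiplier S →* Multiplier T where
  toFun m :=
    { left := fun t => α (m.left (α.symm t))
      right := fun t => α (m.right (α.symm t))
      left_mul := fun s t => by rw [map_mul, m.left_mul, map_mul, α.apply_symm_apply]
      mul_right := fun s t => by rw [map_mul, m.mul_right, map_mul, α.apply_symm_apply]
      mul_left := fun s t => by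
        apply α.symm.injective
        simp only [map_mul, α.symm_apply_apply, m.mul_left] }
  map_one' := by
    apply Multiplier.ext <;> funext t
    · exact α.apply_symm_apply t
    · exact α.apply_symm_apply t
  map_mul' m n := by
    apply Multiplier.ext <;> funext t
    · simp only [mul_left_apply, α.symm_apply_apply]
    · simp only [mul_right_apply, α.symm_apply_apply]

end Multiplier

/-! ### Isomorphisms between ideals -/

/-- Two-sided ideals (as subsemigroups; they are closed under multiplication automatically). -/
def IsIdeal {S : Type u} [Semigroup S] (I : Subsemigroup S) : Prop :=
  ∀ a x : S, x ∈ I → a * x ∈ I ∧ x * a ∈ I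

section Ideals

variable {S : Type u} [InverseSemigroup S]

theorem IsIdeal.inv_mul_mem {I : Subsemigroup S} (hI : IsIdeal I) {x : S} (hx : x ∈ I) :
    x⁻¹ * x ∈ I := (hI _ _ hx).1

theorem IsIdeal.mul_inv_mem {I : Subsemigroup S} (hI : IsIdeal I) {x : S} (hx : x ∈ I) :
    x * x⁻¹ ∈ I := (hI _ _ hx).2

theorem IsIdeal.left_mem {I J : Subsemigroup S} (hI : IsIdeal I) (hJ : IsIdeal J)
    (m : Multiplier I) (x : I) (hx : (x : S) ∈ J) :
    (m.left x : S) ∈ J ∧ (m.right x : S) ∈ J := by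
  have h1 : x = ⟨(x : S) * (x : S)⁻¹, hI.mul_inv_mem x.2⟩ * x :=
    Subtype.ext (InverseSemigroup.mul_inv_mul (x : S)).symm
  have h2 : x = x * ⟨(x : S)⁻¹ * (x : S), hI.inv_mul_mem x.2⟩ :=
    Subtype.ext (by
      change (x : S) = (x : S) * ((x : S)⁻¹ * (x : S))
      rw [← mul_assoc, InverseSemigroup.mul_inv_mul])
  constructor
  · rw [h1, m.left_mul]
    exact (hJ _ _ hx).1
  · rw [h2, m.mul_right]
    exact (hJ _ _ hx).2

/-- In an ideal of an inverse semigroup one has `(m s) n = m (s n)`. -/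
theorem IsIdeal.left_right_comm {I : Subsemigroup S} (hI : IsIdeal I) (m n : Multiplier I) (x : I) :
    n.right (m.left x) = m.left (n.right x) := by
  have h2 : x = x * ⟨(x : S)⁻¹ * (x : S), hI.inv_mul_mem x.2⟩ :=
    Subtype.ext (by
      change (x : S) = (x : S) * ((x : S)⁻¹ * (x : S))
      rw [← mul_assoc, InverseSemigroup.mul_inv_mul])
  rw [h2, m.left_mul, n.mul_right, n.mul_right, m.left_mul]

/-- Restriction of multipliers of an ideal `I` to a smaller ideal `J`. -/
def Multiplier.restrict {I J : Subsemigroup S} (hI : IsIdeal I) (hJ : IsIdeal J) (hJI : J ≤ I) :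
    Multiplier I →* Multiplier J where
  toFun m :=
    { left := fun x => ⟨m.left ⟨x, hJI x.2⟩, (hI.left_mem hJ m ⟨x, hJI x.2⟩ x.2).1⟩
      right := fun x => ⟨m.right ⟨x, hJI x.2⟩, (hI.left_mem hJ m ⟨x, hJI x.2⟩ x.2).2⟩
      left_mul := fun s t => by
        have h := congrArg Subtype.val (m.left_mul ⟨s, hJI s.2⟩ ⟨t, hJI t.2⟩)
        exact Subtype.ext h
      mul_right := fun s t => by
        have h := congrArg Subtype.val (m.mul_right ⟨s, hJI s.2⟩ ⟨t, hJI t.2⟩)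
        exact Subtype.ext h
      mul_left := fun s t => by
        have h := congrArg Subtype.val (m.mul_left ⟨s, hJI s.2⟩ ⟨t, hJI t.2⟩)
        exact Subtype.ext h }
  map_one' := rfl
  map_mul' _ _ := rfl

end Ideals

/-- The elements of `Σ(S)`: those elements of the symmetric inverse monoid of `S` (partial
bijections of `S`) which are isomorphisms between ideals of `S`. Here `b ∈ toPEquiv a` means that
`a` belongs to the domain and is mapped to `b`. -/
@[ext]
structure IdealIso (S : Type u) [Semigroup S] where
  toPEquiv : S ≃. S
  dom_ideal : ∀ a x y : S, y ∈ toPEquiv x →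
    (∃ z, z ∈ toPEquiv (a * x)) ∧ (∃ z, z ∈ toPEquiv (x * a))
  ran_ideal : ∀ b x y : S, y ∈ toPEquiv x →
    (∃ z, b * y ∈ toPEquiv z) ∧ (∃ z, y * b ∈ toPEquiv z)
  map_mul : ∀ x x' y y' : S, y ∈ toPEquiv x → y' ∈ toPEquiv x' → y * y' ∈ toPEquiv (x * x')

namespace IdealIso

section Basic

variable {S : Type u} [Semigroup S]

/-- The domain of an isomorphism between ideals. -/
def dom (φ : IdealIso S) : Subsemigroup S where
  carrier := {x | ∃ y, y ∈ φ.toPEquiv x}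
  mul_mem' := fun {a _} _ ⟨_, hy⟩ => (φ.dom_ideal a _ _ hy).1

/-- The range of an isomorphism between ideals. -/
def ran (φ : IdealIso S) : Subsemigroup S where
  carrier := {y | ∃ x, y ∈ φ.toPEquiv x}
  mul_mem' := fun {b _} _ ⟨_, hx⟩ => (φ.ran_ideal b _ _ hx).1

theorem isIdeal_dom (φ : IdealIso S) : IsIdeal φ.dom := fun a _ ⟨_, hy⟩ => φ.dom_ideal a _ _ hy

theorem isIdeal_ran (φ : IdealIso S) : IsIdeal φ.ran := fun b _ ⟨_, hx⟩ => φ.ran_ideal b _ _ hx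

theorem map_unique (φ : IdealIso S) {x y z : S} (hy : y ∈ φ.toPEquiv x) (hz : z ∈ φ.toPEquiv x) :
    y = z := Option.mem_unique hy hz

/-- An element of `Σ(S)` as an isomorphism from its domain onto its range. -/
noncomputable def equiv (φ : IdealIso S) : φ.dom ≃* φ.ran where
  toFun x := ⟨x.2.choose, x.1, x.2.choose_spec⟩
  invFun y := ⟨y.2.choose, y.1, y.2.choose_spec⟩
  left_inv x := Subtype.ext
    (φ.toPEquiv.inj (Exists.choose_spec (p := fun z => x.2.choose ∈ φ.toPEquiv z) _)
      x.2.choose_spec)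
  right_inv y := Subtype.ext
    (φ.map_unique (Exists.choose_spec (p := fun z => z ∈ φ.toPEquiv y.2.choose) _)
      y.2.choose_spec)
  map_mul' x x' := Subtype.ext
    (φ.map_unique (x * x').2.choose_spec
      (φ.map_mul _ _ _ _ x.2.choose_spec x'.2.choose_spec))

theorem equiv_mem (φ : IdealIso S) (x : φ.dom) : (φ.equiv x : S) ∈ φ.toPEquiv x :=
  x.2.choose_spec

end Basic

section Comp

variable {S : Type u} [InverseSemigroup S]

/-- The inverse isomorphism. -/
def symm (φ : IdealIso S) : IdealIso S where
  toPEquiv := φ.toPEquiv.symm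
  dom_ideal := fun a x y h => by
    have := φ.ran_ideal a y x (φ.toPEquiv.mem_iff_mem.1 h)
    simpa only [PEquiv.mem_iff_mem] using this
  ran_ideal := fun a x y h => by
    have := φ.dom_ideal a y x (φ.toPEquiv.mem_iff_mem.1 h)
    simpa only [PEquiv.mem_iff_mem] using this
  map_mul := fun x x' y y' h h' => by
    rw [PEquiv.mem_iff_mem] at h h' ⊢
    exact φ.map_mul _ _ _ _ h h'

theorem mem_symm {φ : IdealIso S} {x y : S} : x ∈ φ.symm.toPEquiv y ↔ y ∈ φ.toPEquiv x :=
  PEquiv.mem_iff_mem _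

theorem comp_dom_ideal (φ ψ : IdealIso S) (a x z : S)
    (hz : z ∈ ψ.toPEquiv.trans φ.toPEquiv x) :
    (∃ t, t ∈ ψ.toPEquiv.trans φ.toPEquiv (a * x)) ∧
      (∃ t, t ∈ ψ.toPEquiv.trans φ.toPEquiv (x * a)) := by
  obtain ⟨y, hy, hz⟩ := (PEquiv.mem_trans _ _ _ _).1 hz
  obtain ⟨⟨c, hc⟩, ⟨d, hd⟩⟩ := ψ.dom_ideal a x y hy
  constructor
  · obtain ⟨e, he⟩ := (ψ.ran_ideal y⁻¹ x y hy).1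
    have h1 := ψ.map_mul _ _ _ _ hy he
    rw [← mul_assoc, InverseSemigroup.mul_inv_mul] at h1
    have h2 : x = x * e := ψ.toPEquiv.inj hy h1
    have h3 := ψ.map_mul _ _ _ _ hc he
    rw [mul_assoc, ← h2] at h3
    obtain ⟨t, ht⟩ := (φ.isIdeal_dom (c * y⁻¹) y ⟨z, hz⟩).1
    rw [mul_assoc] at ht
    exact ⟨t, (PEquiv.mem_trans _ _ _ _).2 ⟨_, h3, ht⟩⟩
  · obtain ⟨e, he⟩ := (ψ.ran_ideal y⁻¹ x y hy).2
    have h1 := ψ.map_mul _ _ _ _ he hy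
    rw [InverseSemigroup.mul_inv_mul] at h1
    have h2 : x = e * x := ψ.toPEquiv.inj hy h1
    have h3 := ψ.map_mul _ _ _ _ he hd
    rw [← mul_assoc e, ← h2] at h3
    obtain ⟨t, ht⟩ := (φ.isIdeal_dom (y⁻¹ * d) y ⟨z, hz⟩).2
    rw [← mul_assoc] at ht
    exact ⟨t, (PEquiv.mem_trans _ _ _ _).2 ⟨_, h3, ht⟩⟩

/-- `Σ(S)` is a monoid under the composition `φ ∘ ψ` of partial bijections (`ψ` is applied
first); its identity is the identity map of `S`. -/
instance : Monoid (IdealIso S) where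
  mul φ ψ :=
    { toPEquiv := ψ.toPEquiv.trans φ.toPEquiv
      dom_ideal := comp_dom_ideal φ ψ
      ran_ideal := fun b x z hz => by
        have h := comp_dom_ideal ψ.symm φ.symm b z x (by
          rw [PEquiv.mem_trans] at hz ⊢
          obtain ⟨y, h1, h2⟩ := hz
          exact ⟨y, mem_symm.2 h2, mem_symm.2 h1⟩)
        simp only [PEquiv.mem_trans, mem_symm] at h ⊢
        obtain ⟨⟨t, y, h1, h2⟩, ⟨t', y', h1', h2'⟩⟩ := h
        exact ⟨⟨t, y, h2, h1⟩, ⟨t', y', h2', h1'⟩⟩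
      map_mul := fun x x' z z' hz hz' => by
        obtain ⟨y, hy, hz⟩ := (PEquiv.mem_trans _ _ _ _).1 hz
        obtain ⟨y', hy', hz'⟩ := (PEquiv.mem_trans _ _ _ _).1 hz'
        exact (PEquiv.mem_trans _ _ _ _).2
          ⟨_, ψ.map_mul _ _ _ _ hy hy', φ.map_mul _ _ _ _ hz hz'⟩ }
  one :=
    { toPEquiv := PEquiv.refl S
      dom_ideal := fun _ _ _ _ => ⟨⟨_, rfl⟩, ⟨_, rfl⟩⟩
      ran_ideal := fun _ _ _ _ => ⟨⟨_, rfl⟩, ⟨_, rfl⟩⟩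
      map_mul := fun x x' y y' hy hy' => by
        cases hy
        cases hy'
        rfl }
  mul_assoc _ _ _ := IdealIso.ext (PEquiv.trans_assoc _ _ _).symm
  one_mul _ := IdealIso.ext (PEquiv.trans_refl _)
  mul_one _ := IdealIso.ext (PEquiv.refl_trans _)

theorem mem_mul {φ ψ : IdealIso S} {x z : S} :
    z ∈ (φ * ψ).toPEquiv x ↔ ∃ y, y ∈ ψ.toPEquiv x ∧ z ∈ φ.toPEquiv y :=
  PEquiv.mem_trans _ _ _ _

end Comp

section Sim

variable {S : Type u} [InverseSemigroup S]

/-- The relation `ψ ∼ φ` on `Σ(S)`: the two isomorphisms have the same domain and the same range,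
and `ψ(s) = m φ(s) m⁻¹` on the domain for some invertible multiplier `m` of the range. -/
def Sim (ψ φ : IdealIso S) : Prop :=
  φ.dom = ψ.dom ∧ φ.ran = ψ.ran ∧
    ∃ m : (Multiplier φ.ran)ˣ, ∀ (s : S) (t : φ.ran),
      (t : S) ∈ φ.toPEquiv s → ((Multiplier.conj m t : φ.ran) : S) ∈ ψ.toPEquiv s

theorem conj_conj {I : Subsemigroup S} (hI : IsIdeal I) (m n : (Multiplier I)ˣ) (x : I) :
    Multiplier.conj m (Multiplier.conj n x) = Multiplier.conj (m * n) x := by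
  simp only [Multiplier.conj, mul_inv_rev, Units.val_mul, Multiplier.mul_left_apply,
    Multiplier.mul_right_apply]
  exact congrArg _ (hI.left_right_comm m.val (n⁻¹ : (Multiplier I)ˣ).val (n.val.left x)).symm

theorem conj_one {I : Subsemigroup S} (x : I) : Multiplier.conj (1 : (Multiplier I)ˣ) x = x := rfl

theorem conj_mem {I J : Subsemigroup S} (hI : IsIdeal I) (hJ : IsIdeal J) (m : (Multiplier I)ˣ)
    (x : I) (hx : (x : S) ∈ J) : ((Multiplier.conj m x : I) : S) ∈ J :=
  (hI.left_mem hJ _ _ (hI.left_mem hJ _ _ hx).1).2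

theorem mem_of_conj_mem {I J : Subsemigroup S} (hI : IsIdeal I) (hJ : IsIdeal J)
    (m : (Multiplier I)ˣ) (x : I) (hx : ((Multiplier.conj m x : I) : S) ∈ J) : (x : S) ∈ J := by
  have h := conj_mem hI hJ m⁻¹ _ hx
  rwa [conj_conj hI, inv_mul_cancel, conj_one] at h

theorem conj_restrict {I J : Subsemigroup S} (hI : IsIdeal I) (hJ : IsIdeal J) (hJI : J ≤ I)
    (m : (Multiplier I)ˣ) (x : J) :
    ((Multiplier.conj (Units.map (Multiplier.restrict hI hJ hJI) m) x : J) : S) =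
      (Multiplier.conj m ⟨x, hJI x.2⟩ : I) := rfl

theorem conj_transfer {S T : Type*} [Mul S] [Mul T] (α : S ≃* T) (m : (Multiplier S)ˣ) (t : T) :
    Multiplier.conj (Units.map (Multiplier.transfer α) m) t =
      α (Multiplier.conj m (α.symm t)) := by
  change α ((m⁻¹ : (Multiplier S)ˣ).val.right (α.symm (α (m.val.left (α.symm t))))) = _
  rw [α.symm_apply_apply]
  rfl

theorem Sim.refl (φ : IdealIso S) : Sim φ φ := ⟨rfl, rfl, 1, fun _ _ h => h⟩

theorem Sim.symm {ψ φ : IdealIso S} (h : Sim ψ φ) : Sim φ ψ := by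
  obtain ⟨hd, hr, m, hm⟩ := h
  refine ⟨hd.symm, hr.symm,
    Units.map (Multiplier.restrict φ.isIdeal_ran ψ.isIdeal_ran hr.ge) m⁻¹, fun s t ht => ?_⟩
  rw [conj_restrict]
  have hs : s ∈ φ.dom := by
    rw [hd]
    exact ⟨_, ht⟩
  obtain ⟨t', ht'⟩ := hs
  have h1 := hm s ⟨t', s, ht'⟩ ht'
  have h2 : (⟨t, hr.ge t.2⟩ : φ.ran) = Multiplier.conj m ⟨t', s, ht'⟩ :=
    Subtype.ext (ψ.map_unique ht h1)
  rw [h2, conj_conj φ.isIdeal_ran, inv_mul_cancel, conj_one]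
  exact ht'

theorem Sim.trans {χ ψ φ : IdealIso S} (h : Sim χ ψ) (h' : Sim ψ φ) : Sim χ φ := by
  obtain ⟨hd, hr, m, hm⟩ := h
  obtain ⟨hd', hr', n, hn⟩ := h'
  refine ⟨hd'.trans hd, hr'.trans hr,
    Units.map (Multiplier.restrict ψ.isIdeal_ran φ.isIdeal_ran hr'.le) m * n, fun s t ht => ?_⟩
  rw [← conj_conj φ.isIdeal_ran, conj_restrict]
  exact hm _ _ (hn s t ht)

theorem Sim.mul_right {ψ φ : IdealIso S} (h : Sim ψ φ) (α : IdealIso S) :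
    Sim (ψ * α) (φ * α) := by
  have key : ∀ {ψ φ : IdealIso S}, Sim ψ φ → (φ * α).ran ≤ (ψ * α).ran := by
    rintro ψ φ ⟨hd, hr, m, hm⟩ z ⟨x, hz⟩
    obtain ⟨y, hy, hz⟩ := mem_mul.1 hz
    exact mem_of_conj_mem φ.isIdeal_ran (ψ * α).isIdeal_ran m ⟨z, y, hz⟩
      ⟨x, mem_mul.2 ⟨y, hy, hm y ⟨z, y, hz⟩ hz⟩⟩
  have key' : ∀ {ψ φ : IdealIso S}, Sim ψ φ → (φ * α).dom ≤ (ψ * α).dom := by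
    rintro ψ φ ⟨hd, hr, m, hm⟩ x ⟨z, hz⟩
    obtain ⟨y, hy, hz⟩ := mem_mul.1 hz
    exact ⟨_, mem_mul.2 ⟨y, hy, hm y ⟨z, y, hz⟩ hz⟩⟩
  have hle : (φ * α).ran ≤ φ.ran := by
    rintro z ⟨x, hz⟩
    obtain ⟨y, hy, hz⟩ := mem_mul.1 hz
    exact ⟨y, hz⟩
  refine ⟨le_antisymm (key' h) (key' h.symm), le_antisymm (key h) (key h.symm), ?_⟩
  obtain ⟨hd, hr, m, hm⟩ := h
  refine ⟨Units.map (Multiplier.restrict φ.isIdeal_ran (φ * α).isIdeal_ran hle) m,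
    fun s t ht => ?_⟩
  rw [conj_restrict]
  obtain ⟨y, hy, hz⟩ := mem_mul.1 ht
  exact mem_mul.2 ⟨y, hy, hm y ⟨t, y, hz⟩ hz⟩

theorem Sim.mul_left {ψ φ : IdealIso S} (h : Sim ψ φ) (α : IdealIso S) :
    Sim (α * ψ) (α * φ) := by
  have key : ∀ {ψ φ : IdealIso S}, Sim ψ φ → (α * φ).ran ≤ (α * ψ).ran := by
    rintro ψ φ ⟨hd, hr, m, hm⟩ z ⟨x, hz⟩
    obtain ⟨y, hy, hz⟩ := mem_mul.1 hz
    obtain ⟨x', hx'⟩ := hr.le ⟨x, hy⟩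
    exact ⟨x', mem_mul.2 ⟨y, hx', hz⟩⟩
  have key' : ∀ {ψ φ : IdealIso S}, Sim ψ φ → (α * φ).dom ≤ (α * ψ).dom := by
    rintro ψ φ ⟨hd, hr, m, hm⟩ x ⟨z, hz⟩
    obtain ⟨y, hy, hz⟩ := mem_mul.1 hz
    obtain ⟨z', hz'⟩ := conj_mem φ.isIdeal_ran α.isIdeal_dom m ⟨y, x, hy⟩ ⟨z, hz⟩
    exact ⟨z', mem_mul.2 ⟨_, hm x ⟨y, x, hy⟩ hy, hz'⟩⟩
  refine ⟨le_antisymm (key' h) (key' h.symm), le_antisymm (key h) (key h.symm), ?_⟩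
  obtain ⟨hd, hr, m, hm⟩ := h
  -- `χ` is the restriction of `α` to the intersection of `φ.ran` with `α.dom`
  let χ : IdealIso S := α * (φ * φ.symm)
  have hχ : ∀ y z : S, z ∈ χ.toPEquiv y ↔ y ∈ φ.ran ∧ z ∈ α.toPEquiv y := by
    intro y z
    constructor
    · intro hz
      obtain ⟨y', hy', hz⟩ := mem_mul.1 hz
      obtain ⟨x, hx, hy'⟩ := mem_mul.1 hy'
      have : y = y' := φ.map_unique (mem_symm.1 hx) hy'
      subst this
      exact ⟨⟨x, hy'⟩, hz⟩
    · rintro ⟨⟨x, hx⟩, hz⟩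
      exact mem_mul.2 ⟨y, mem_mul.2 ⟨x, mem_symm.2 hx, hx⟩, hz⟩
  have h1 : χ.dom ≤ φ.ran := by
    rintro y ⟨z, hz⟩
    exact ((hχ _ _).1 hz).1
  have h2 : (α * φ).ran ≤ χ.ran := by
    rintro z ⟨x, hz⟩
    obtain ⟨y, hy, hz⟩ := mem_mul.1 hz
    exact ⟨y, (hχ _ _).2 ⟨⟨x, hy⟩, hz⟩⟩
  refine ⟨Units.map (Multiplier.restrict χ.isIdeal_ran (α * φ).isIdeal_ran h2)
    (Units.map (Multiplier.transfer χ.equiv)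
      (Units.map (Multiplier.restrict φ.isIdeal_ran χ.isIdeal_dom h1) m)), fun s u hu => ?_⟩
  rw [conj_restrict, conj_transfer]
  obtain ⟨t, ht, hu'⟩ := mem_mul.1 hu
  have htχ : (u : S) ∈ χ.toPEquiv t := (hχ _ _).2 ⟨⟨s, ht⟩, hu'⟩
  have h3 : χ.equiv.symm ⟨u, h2 u.2⟩ = ⟨t, _, htχ⟩ := by
    rw [MulEquiv.symm_apply_eq]
    exact Subtype.ext (χ.map_unique htχ (χ.equiv_mem ⟨t, _, htχ⟩))
  rw [h3]
  have h4 := ((hχ _ _).1 (χ.equiv_mem (Multiplier.conj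
    (Units.map (Multiplier.restrict φ.isIdeal_ran χ.isIdeal_dom h1) m) ⟨t, _, htχ⟩))).2
  rw [conj_restrict] at h4
  exact mem_mul.2 ⟨_, hm s ⟨t, s, ht⟩ ht, h4⟩

end Sim

end IdealIso

/-- The congruence `∼` on the monoid `Σ(S)`. -/
def simCon (S : Type u) [InverseSemigroup S] : Con (IdealIso S) where
  r := IdealIso.Sim
  iseqv := ⟨IdealIso.Sim.refl, IdealIso.Sim.symm, IdealIso.Sim.trans⟩
  mul' h h' := (h.mul_right _).trans (h'.mul_left _)

/-- The monoid `ς(S) = Σ(S)/∼`, with the multiplication induced by composition. -/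
abbrev Varsigma (S : Type u) [InverseSemigroup S] : Type u := (simCon S).Quotient

/-- The class `[φ]` in `ς(S)` of an isomorphism `φ` between ideals of `S`. -/
def Varsigma.mk {S : Type u} [InverseSemigroup S] (φ : IdealIso S) : Varsigma S :=
  (φ : (simCon S).Quotient)

/-- A unital partial homomorphism from a group to a monoid. -/
structure IsUnitalPartialHom {G : Type u} {M : Type v} [Group G] [Monoid M] (f : G → M) : Prop where
  inv_mul_mul : ∀ g h : G, f g⁻¹ * f g * f h = f g⁻¹ * f (g * h)
  mul_mul_inv : ∀ g h : G, f g * f h * f h⁻¹ = f (g * h) * f h⁻¹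
  map_one : f 1 = 1

/-! ### Extensions -/

/-- `A → U → S` is an extension of `A` by the inverse semigroup `S`: `i` is a
monomorphism, `π` is an idempotent-separating epimorphism, and `i(A) = π⁻¹(E(S))`. -/
structure IsExtension {A : Type u} {U : Type v} {S : Type w} [InverseSemigroup A]
    [InverseSemigroup U] [InverseSemigroup S] (i : A →ₙ* U) (π : U →ₙ* S) : Prop where
  injective : Function.Injective i
  surjective : Function.Surjective π
  separating : ∀ e f : U, IsIdempotentElem e → IsIdempotentElem f → π e = π f → e = f
  exact : ∀ z : U, (∃ a : A, i a = z) ↔ IsIdempotentElem (π z)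

/-- An extension `A → U → G` of `A` by the group `G`: `U` is an inverse semigroup, `i` is
a monomorphism, `j` is an epimorphism, and `i(A) = j⁻¹(1)`. -/
structure Extension (A : Type u) (U : Type v) (G : Type w) [InverseSemigroup A]
    [InverseSemigroup U] [Group G] where
  i : A →ₙ* U
  j : U →ₙ* G
  injective : Function.Injective i
  surjective : Function.Surjective j
  exact : ∀ z : U, (∃ a : A, i a = z) ↔ j z = 1

namespace Extension

variable {A : Type u} {U : Type v} {G : Type w} [InverseSemigroup A] [InverseSemigroup U] [Group G]

/-- Two extensions of `A` by `G` are equivalent if there is an isomorphism of the middle terms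
which commutes with the maps from `A` and to `G`. -/
def Equivalent {U' : Type x} [InverseSemigroup U'] (E : Extension A U G) (E' : Extension A U' G) :
    Prop :=
  ∃ μ : U ≃* U', (∀ a : A, μ (E.i a) = E'.i a) ∧ ∀ z : U, E'.j (μ z) = E.j z

/-- A refinement of an extension `A → U → G`: a factorization `j = κ ∘ π` through an
inverse semigroup `S`, with epimorphisms `π : U → S` and `κ : S → G`, such that
`A → U → S` is an extension of `A` by `S`. Here `κ⁻¹(1)` is necessarily `E(S)`, so that
`S` is `E`-unitary and `κ` induces an isomorphism of the maximal group image of `S` with `G`. -/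
structure Refinement (E : Extension A U G) (S : Type y) [InverseSemigroup S] where
  π : U →ₙ* S
  κ : S →ₙ* G
  isExtension : IsExtension E.i π
  surjective : Function.Surjective κ
  comp : ∀ z : U, κ (π z) = E.j z

namespace Refinement

variable {E : Extension A U G} {S : Type y} [InverseSemigroup S]

/-- `ρ : S → U` is an order-preserving transversal of `π`. -/
structure IsOrderPreservingTransversal (R : E.Refinement S) (ρ : S → U) : Prop where
  section_eq : ∀ s : S, R.π (ρ s) = s
  map_idempotent : ∀ e : S, IsIdempotentElem e → IsIdempotentElem (ρ e)
  monotone : ∀ s t : S, NatLE s t → NatLE (ρ s) (ρ t)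

/-- `θ` is the component `θ_g : D_{g⁻¹} → D_g` of the action part of the twisted partial action of
`G` on `A` induced by the refinement `R` and the transversal `ρ`. With
`α(e) = i⁻¹(ρ(e))` for an idempotent `e` and `λ_s(a) = i⁻¹(ρ(s) i(a) ρ(s)⁻¹)`,
* the domain `D_{g⁻¹}` consists of all `a` such that `α(s⁻¹ s) = a a⁻¹` for some `s` over `g`,
* the range `D_g` consists of all `b` such that `α(s s⁻¹) = b b⁻¹` for some `s` over `g`,
* `θ_g(a) = λ_s(a)` whenever `s` lies over `g` and `α(s⁻¹ s) = a a⁻¹`. -/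
structure Induces (R : E.Refinement S) (ρ : S → U) (g : G) (θ : IdealIso A) : Prop where
  mem_dom : ∀ a : A, a ∈ θ.dom ↔ ∃ s : S, R.κ s = g ∧ ρ (s⁻¹ * s) = E.i (a * a⁻¹)
  mem_ran : ∀ b : A, b ∈ θ.ran ↔ ∃ s : S, R.κ s = g ∧ ρ (s * s⁻¹) = E.i (b * b⁻¹)
  apply_eq : ∀ (s : S) (a b : A), R.κ s = g → ρ (s⁻¹ * s) = E.i (a * a⁻¹) → b ∈ θ.toPEquiv a →
    E.i b = ρ s * E.i a * (ρ s)⁻¹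

/-- `ψ : G → ς(A)` is the abstract kernel `g ↦ [θ_g]`, where `θ` is the action part of the twisted
partial action of `G` on `A` induced by the refinement `R` and the order-preserving transversal
`ρ`. (The conditions in `Induces` determine `θ_g`.) -/
def IsAbstractKernel (R : E.Refinement S) (ρ : S → U) (ψ : G → Varsigma A) : Prop :=
  ∀ g : G, ∃ θ : IdealIso A, R.Induces ρ g θ ∧ ψ g = Varsigma.mk θ

end Refinement

/-- An extension of `A` by `G` is admissible if it has a refinement `A → U → S` such that
`π` admits an order-preserving transversal. (As `S` is a homomorphic image of `U`, nothing is lost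
by taking it in the universe of `U`.) -/
def IsAdmissible (E : Extension A U G) : Prop :=
  ∃ (S : Type v) (_ : InverseSemigroup S) (R : E.Refinement S) (ρ : S → U),
    R.IsOrderPreservingTransversal ρ

end Extension

end PartialExt

/-! Everything reduces to data inside `U`. For a refinement with transversal `ρ`, put `τ = ρ ∘ π : U
→ U`. Since `π` separates idempotents and `π (u v⁻¹)` is idempotent when `j u = j v`, the value `τ
u` depends only on `j u` and `u⁻¹ u`; order preservation becomes `τ (u f) = τ u * f` for idempotent
`f`. These properties (`IsOrderedRetraction`) mention only the extension. In these terms `θ_g` is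
conjugation by `τ u`, for `u` over `g` with `u⁻¹ u = a a⁻¹`, and its domain does not involve `τ` at
all.

The central lemma is `Implements.sim`: two ideal isomorphisms with the same domain, given by
conjugation with families `c`, `d` over the same `g` compatible with restriction, are `∼`-related.
Indeed `d a * (c a)⁻¹` lies in `j⁻¹(1) = i(A)`; these quotients form a compatible family in `A`,
which defines an invertible multiplier conjugating one isomorphism into the other.

Applied to two retractions, this gives independence of the choices. Applied to composites
(`Implements.mul`), it reduces the partial homomorphism laws to equalities of domains, because both
sides lie over the same group element. A refinement of the second extension is pulled back to the
first along the equivalence. -/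

namespace PartialExt

universe u v w x y

/-! ### Calculus in inverse semigroups: commuting idempotents and the natural order -/

namespace InverseSemigroup

variable {S : Type u} {T : Type v} [InverseSemigroup S] [InverseSemigroup T]

theorem mul_inv_mul' (a : S) : a * (a⁻¹ * a) = a := by
  rw [← mul_assoc, mul_inv_mul]

theorem inv_mul_inv' (a : S) : a⁻¹ * (a * a⁻¹) = a⁻¹ := by
  rw [← mul_assoc, inv_mul_inv]

theorem mul_inv_mul_assoc (a x : S) : a * (a⁻¹ * (a * x)) = a * x := by
  rw [← mul_assoc a⁻¹, ← mul_assoc, mul_inv_mul']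

theorem inv_inv (a : S) : a⁻¹⁻¹ = a :=
  (inv_unique _ _ (inv_mul_inv a) (mul_inv_mul a)).symm

theorem inv_eq_of_idem {e : S} (he : IsIdempotentElem e) : e⁻¹ = e :=
  (inv_unique _ _ (by rw [he.eq, he.eq]) (by rw [he.eq, he.eq])).symm

theorem idem_mul_self_mul {e : S} (he : IsIdempotentElem e) (x : S) : e * (e * x) = e * x := by
  rw [← mul_assoc, he.eq]

/-- By uniqueness of inverses `(e f)⁻¹ = f (e f)⁻¹ e`, and the right side squares to itself. So `(e
f)⁻¹` is idempotent, hence its own inverse, and equals `e f`. -/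
theorem idem_mul_idem {e f : S} (he : IsIdempotentElem e) (hf : IsIdempotentElem f) :
    IsIdempotentElem (e * f) := by
  have h1 : f * (e * f)⁻¹ * e = (e * f)⁻¹ := by
    apply inv_unique
    · calc e * f * (f * (e * f)⁻¹ * e) * (e * f) = e * (f * f) * (e * f)⁻¹ * ((e * e) * f) := by
            simp only [mul_assoc]
        _ = e * f := by rw [he.eq, hf.eq, mul_inv_mul]
    · calc f * (e * f)⁻¹ * e * (e * f) * (f * (e * f)⁻¹ * e)
          = f * ((e * f)⁻¹ * ((e * e) * (f * f)) * (e * f)⁻¹) * e := by simp only [mul_assoc]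
        _ = f * (e * f)⁻¹ * e := by rw [he.eq, hf.eq, inv_mul_inv]
  have h2 : IsIdempotentElem (e * f)⁻¹ := by
    have : (f * (e * f)⁻¹ * e) * (f * (e * f)⁻¹ * e) = f * (e * f)⁻¹ * e := by
      calc _ = f * ((e * f)⁻¹ * (e * f) * (e * f)⁻¹) * e := by simp only [mul_assoc]
        _ = _ := by rw [inv_mul_inv]
    rwa [h1] at this
  have h3 := inv_eq_of_idem h2
  rw [inv_inv] at h3
  rwa [← h3] at h2

/-- Both `f * e` and the idempotent `e * f` itself are inverses of `e * f`. -/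
theorem idem_comm {e f : S} (he : IsIdempotentElem e) (hf : IsIdempotentElem f) :
    e * f = f * e := by
  have h1 := idem_mul_idem he hf
  have h2 := idem_mul_idem hf he
  have h3 : f * e = (e * f)⁻¹ := by
    apply inv_unique
    · calc e * f * (f * e) * (e * f) = e * (f * f) * ((e * e) * f) := by simp only [mul_assoc]
        _ = e * f := by rw [he.eq, hf.eq, h1.eq]
    · calc f * e * (e * f) * (f * e) = f * (e * e) * ((f * f) * e) := by simp only [mul_assoc]
        _ = f * e := by rw [he.eq, hf.eq, h2.eq]
  rw [h3, inv_eq_of_idem h1]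

theorem idem_left_comm {e f : S} (he : IsIdempotentElem e) (hf : IsIdempotentElem f) (x : S) :
    e * (f * x) = f * (e * x) := by
  rw [← mul_assoc, idem_comm he hf, mul_assoc]

theorem idem_inv_mul (a : S) : IsIdempotentElem (a⁻¹ * a) := by
  rw [IsIdempotentElem, ← mul_assoc, inv_mul_inv]

theorem idem_mul_inv (a : S) : IsIdempotentElem (a * a⁻¹) := by
  rw [IsIdempotentElem, ← mul_assoc, mul_inv_mul]

theorem mul_inv_rev (a b : S) : (a * b)⁻¹ = b⁻¹ * a⁻¹ := by
  symm
  apply inv_unique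
  · calc a * b * (b⁻¹ * a⁻¹) * (a * b) = a * ((b * b⁻¹) * (a⁻¹ * a)) * b := by
          simp only [mul_assoc]
      _ = (a * a⁻¹ * a) * (b * b⁻¹ * b) := by
          rw [idem_comm (idem_mul_inv b) (idem_inv_mul a)]; simp only [mul_assoc]
      _ = a * b := by rw [mul_inv_mul, mul_inv_mul]
  · calc b⁻¹ * a⁻¹ * (a * b) * (b⁻¹ * a⁻¹) = b⁻¹ * ((a⁻¹ * a) * (b * b⁻¹)) * a⁻¹ := by
          simp only [mul_assoc]
      _ = (b⁻¹ * b * b⁻¹) * (a⁻¹ * a * a⁻¹) := by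
          rw [idem_comm (idem_inv_mul a) (idem_mul_inv b)]; simp only [mul_assoc]
      _ = b⁻¹ * a⁻¹ := by rw [inv_mul_inv, inv_mul_inv]

theorem map_inv (f : S →ₙ* T) (a : S) : f a⁻¹ = (f a)⁻¹ := by
  apply inv_unique
  · rw [← map_mul, ← map_mul, mul_inv_mul]
  · rw [← map_mul, ← map_mul, inv_mul_inv]

theorem map_idem (f : S →ₙ* T) {e : S} (he : IsIdempotentElem e) : IsIdempotentElem (f e) := by
  rw [IsIdempotentElem, ← map_mul, he.eq]

theorem map_inv_group {G : Type w} [Group G] (f : S →ₙ* G) (a : S) : f a⁻¹ = (f a)⁻¹ := by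
  have h : f a * f a⁻¹ * f a = f a := by rw [← map_mul, ← map_mul, mul_inv_mul]
  exact eq_inv_of_mul_eq_one_right (mul_eq_right.1 h)

theorem map_idem_group {G : Type w} [Group G] (f : S →ₙ* G) {e : S} (he : IsIdempotentElem e) :
    f e = 1 := by
  have h : f e * f e = f e := by rw [← map_mul, he.eq]
  exact mul_eq_left.1 h

/-- If `s ≤ t` then `s = t (s⁻¹ s)`. -/
theorem eq_mul_of_natLE {s t : S} (h : NatLE s t) : s = t * (s⁻¹ * s) := by
  obtain ⟨e, he, rfl⟩ := h
  rw [mul_inv_rev, inv_eq_of_idem he]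
  simp only [mul_assoc]
  rw [idem_mul_self_mul he, ← mul_assoc t⁻¹ e t, ← mul_assoc, ← mul_assoc t t⁻¹,
    ← idem_comm he (idem_mul_inv t), mul_assoc, mul_assoc, mul_inv_mul']

theorem natLE_mul_idem (t : S) {f : S} (hf : IsIdempotentElem f) : NatLE (t * f) t := by
  -- The order is defined by idempotents on the left; conjugating by `t` moves `f` across.
  refine ⟨t * f * t⁻¹, ?_, ?_⟩
  · change t * f * t⁻¹ * (t * f * t⁻¹) = _
    simp only [mul_assoc]
    rw [← mul_assoc t⁻¹ t, idem_left_comm hf (idem_inv_mul t), idem_mul_self_mul hf, mul_assoc,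
      mul_inv_mul_assoc]
  · simp only [mul_assoc]
    rw [idem_comm hf (idem_inv_mul t), mul_assoc, mul_inv_mul_assoc]

end InverseSemigroup

/-! ### Semilattices of groups -/

namespace IsSemilatticeOfGroups

open InverseSemigroup

variable {A : Type u} [InverseSemigroup A] [IsSemilatticeOfGroups A]

/-- Idempotents of a semilattice of groups are central. -/
theorem idem_central {e : A} (he : IsIdempotentElem e) (a : A) : e * a = a * e := by
  -- The identity `x x⁻¹ = x⁻¹ x` for `x = e a`: its left side collapses to `e a⁻¹ a` and its right
  -- side to `a⁻¹ e a`. Multiplying by `a` on the left then gives the claim.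
  have h1 : (e * a) * (a⁻¹ * e) = (a⁻¹ * e) * (e * a) := by
    have := mul_inv_eq_inv_mul (e * a)
    rwa [InverseSemigroup.mul_inv_rev, inv_eq_of_idem he] at this
  have h2 : (a * e) * (e * a⁻¹) = (e * a⁻¹) * (a * e) := by
    have := mul_inv_eq_inv_mul (a * e)
    rwa [InverseSemigroup.mul_inv_rev, inv_eq_of_idem he] at this
  have h3 : a⁻¹ * (e * a) = e * (a⁻¹ * a) := by
    have h : (e * a) * (a⁻¹ * e) = e * (a⁻¹ * a) := by
      rw [mul_assoc, ← mul_assoc a, mul_inv_eq_inv_mul, idem_comm (idem_inv_mul a) he,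
        idem_mul_self_mul he]
    rw [← h, h1, mul_assoc, idem_mul_self_mul he]
  calc e * a = (a * a⁻¹) * (e * a) := by
        rw [← mul_assoc, ← idem_comm he (idem_mul_inv a), mul_assoc, mul_assoc, mul_inv_mul']
    _ = a * e := by
        rw [mul_assoc, h3, idem_comm he (idem_inv_mul a), ← mul_assoc, mul_inv_mul']

theorem mul_mul_inv (a b : A) : (a * b) * (a * b)⁻¹ = (a * a⁻¹) * (b * b⁻¹) := by
  rw [InverseSemigroup.mul_inv_rev, mul_assoc, ← mul_assoc b, idem_central (idem_mul_inv b),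
    ← mul_assoc, mul_assoc]

end IsSemilatticeOfGroups

open InverseSemigroup

/-! ### Inner multipliers given by compatible families -/

section Family

variable {A : Type u} [InverseSemigroup A]

/-- A family of elements `p s`, indexed by an ideal, with `p s` in the same maximal subgroup
as `s` and compatible with restriction along idempotents. -/
structure IsCompatibleFamily (I : Subsemigroup A) (p : I → A) : Prop where
  mul_inv : ∀ s : I, p s * (p s)⁻¹ = s * (s : A)⁻¹
  restrict : ∀ s t : I, (s : A) * (s : A)⁻¹ * t = t → p t = p s * (t * (t : A)⁻¹)

namespace IsCompatibleFamily

variable [IsSemilatticeOfGroups A] {I : Subsemigroup A} {p : I → A}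

/-- Restriction along an equality of idempotents: multiplying `p t` by the identity of its own
maximal subgroup changes nothing. Thus `p` is really a function of the idempotent. -/
theorem eq_of_mul_inv_eq (hp : IsCompatibleFamily I p) {s t : I}
    (h : (s : A) * (s : A)⁻¹ = t * (t : A)⁻¹) : p s = p t := by
  rw [hp.restrict t s (by rw [← h, mul_inv_mul]), h, ← hp.mul_inv t,
    IsSemilatticeOfGroups.mul_inv_eq_inv_mul, mul_inv_mul']

theorem inv (hp : IsCompatibleFamily I p) : IsCompatibleFamily I fun s => (p s)⁻¹ where
  mul_inv s := by
    rw [InverseSemigroup.inv_inv, ← IsSemilatticeOfGroups.mul_inv_eq_inv_mul, hp.mul_inv]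
  restrict s t h := by
    rw [hp.restrict s t h, InverseSemigroup.mul_inv_rev, inv_eq_of_idem (idem_mul_inv _),
      IsSemilatticeOfGroups.idem_central (idem_mul_inv _)]

theorem mul_eq_left (hp : IsCompatibleFamily I p) (s t : I) :
    p (s * t) = p s * (t * (t : A)⁻¹) := by
  have h : p s = p s * (s * (s : A)⁻¹) := by
    rw [← hp.mul_inv s, IsSemilatticeOfGroups.mul_inv_eq_inv_mul, mul_inv_mul']
  rw [hp.restrict s (s * t) (by
    change (s : A) * (s : A)⁻¹ * (s * t) = s * t
    rw [← mul_assoc, mul_inv_mul])]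
  change p s * ((s * t) * ((s : A) * t)⁻¹) = _
  rw [IsSemilatticeOfGroups.mul_mul_inv, ← mul_assoc, ← h]

theorem mul_eq_right (hp : IsCompatibleFamily I p) (s t : I) :
    p (s * t) = p t * (s * (s : A)⁻¹) := by
  rw [← hp.mul_eq_left t s]
  apply hp.eq_of_mul_inv_eq
  change ((s : A) * t) * ((s : A) * t)⁻¹ = (t * s) * ((t : A) * s)⁻¹
  rw [IsSemilatticeOfGroups.mul_mul_inv, IsSemilatticeOfGroups.mul_mul_inv,
    idem_comm (idem_mul_inv _) (idem_mul_inv _)]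

/-- The multiplier `s ↦ p(s) s`, `s ↦ s p(s)`. -/
def multiplier (hI : IsIdeal I) (hp : IsCompatibleFamily I p) : Multiplier I where
  left s := ⟨p s * s, (hI _ _ s.2).1⟩
  right s := ⟨s * p s, (hI _ _ s.2).2⟩
  left_mul s t := Subtype.ext (by
    change p (s * t) * (s * t) = p s * s * (t : A)
    rw [hp.mul_eq_left, mul_assoc, ← mul_assoc ((t : A) * _),
      IsSemilatticeOfGroups.idem_central (idem_mul_inv _), mul_assoc (s : A), mul_inv_mul,
      mul_assoc])
  mul_right s t := Subtype.ext (by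
    change (s : A) * t * p (s * t) = s * (t * p t)
    rw [hp.mul_eq_right, ← IsSemilatticeOfGroups.idem_central (idem_mul_inv _), ← mul_assoc,
      ← IsSemilatticeOfGroups.idem_central (idem_mul_inv _), ← mul_assoc, mul_inv_mul, mul_assoc])
  mul_left s t := Subtype.ext (by
    change (s : A) * (p t * t) = s * p s * t
    -- Both sides are compared with `s * p (s * t) * t`, where `p` is taken on the common
    -- restriction.
    have h1 : (s : A) * (p t * t) = s * p (s * t) * t := by
      rw [hp.mul_eq_right, IsSemilatticeOfGroups.mul_inv_eq_inv_mul,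
        ← IsSemilatticeOfGroups.idem_central (idem_inv_mul _)]
      simp only [mul_assoc]
      rw [mul_inv_mul_assoc]
    have h2 : (s : A) * p s * t = s * p (s * t) * t := by
      rw [hp.mul_eq_left]
      simp only [mul_assoc]
      rw [mul_inv_mul']
    rw [h1, h2])

/-- Multiplying `s` by `(p s)⁻¹` or `p s` stays in its maximal subgroup, so `p` takes the same value
at the product as at `s`, and the factors cancel. -/
theorem multiplier_mul_inv (hI : IsIdeal I) (hp : IsCompatibleFamily I p) :
    hp.multiplier hI * hp.inv.multiplier hI = 1 := by
  have h (s : I) : p s * (p s)⁻¹ * s = s := by rw [hp.mul_inv, mul_inv_mul]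
  have h' (s : I) : (s : A) * (p s * (p s)⁻¹) = s := by
    rw [hp.mul_inv, IsSemilatticeOfGroups.mul_inv_eq_inv_mul, mul_inv_mul']
  have e (s : I) : (p s)⁻¹ * s * ((p s)⁻¹ * s)⁻¹ = s * (s : A)⁻¹ := by
    rw [IsSemilatticeOfGroups.mul_mul_inv, hp.inv.mul_inv, (idem_mul_inv _).eq]
  have e' (s : I) : s * p s * (s * p s)⁻¹ = s * (s : A)⁻¹ := by
    rw [IsSemilatticeOfGroups.mul_mul_inv, hp.mul_inv, (idem_mul_inv _).eq]
  apply Multiplier.ext <;> funext s <;> apply Subtype.ext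
  · change p ⟨(p s)⁻¹ * s, _⟩ * ((p s)⁻¹ * s) = (s : A)
    rw [hp.eq_of_mul_inv_eq (s := ⟨(p s)⁻¹ * s, _⟩) (t := s) (e s), ← mul_assoc, h]
  · change (s * p s) * (p ⟨s * p s, _⟩)⁻¹ = (s : A)
    rw [hp.eq_of_mul_inv_eq (s := ⟨s * p s, _⟩) (t := s) (e' s), mul_assoc, h']

theorem inv_multiplier_mul (hI : IsIdeal I) (hp : IsCompatibleFamily I p) :
    hp.inv.multiplier hI * hp.multiplier hI = 1 := by
  have h := hp.inv.multiplier_mul_inv hI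
  convert h using 3
  funext s
  exact (InverseSemigroup.inv_inv _).symm

/-- The invertible multiplier defined by a compatible family. -/
def unit (hI : IsIdeal I) (hp : IsCompatibleFamily I p) : (Multiplier I)ˣ where
  val := hp.multiplier hI
  inv := hp.inv.multiplier hI
  val_inv := hp.multiplier_mul_inv hI
  inv_val := hp.inv_multiplier_mul hI

theorem conj_unit (hI : IsIdeal I) (hp : IsCompatibleFamily I p) (s : I) :
    ((Multiplier.conj (hp.unit hI) s : I) : A) = p s * s * (p s)⁻¹ := by
  change p s * s * (p ⟨p s * s, _⟩)⁻¹ = _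
  rw [hp.eq_of_mul_inv_eq (s := ⟨p s * s, _⟩) (t := s)]
  change p s * s * (p s * s)⁻¹ = _
  rw [IsSemilatticeOfGroups.mul_mul_inv, hp.mul_inv, (idem_mul_inv _).eq]

end IsCompatibleFamily

end Family

/-! ### Ideal isomorphisms respect inverses and restriction -/

namespace IdealIso

variable {A : Type u} [InverseSemigroup A]

/-- The element `a⁻¹ = a⁻¹ a a⁻¹` lies in the domain ideal, and its image satisfies the equations
characterizing `b⁻¹`. -/
theorem map_inv (φ : IdealIso A) {a b : A} (h : b ∈ φ.toPEquiv a) : b⁻¹ ∈ φ.toPEquiv a⁻¹ := by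
  have ha : a⁻¹ ∈ φ.dom := by
    rw [← inv_mul_inv a]
    exact (φ.isIdeal_dom _ _ (φ.isIdeal_dom a⁻¹ a ⟨b, h⟩).1).2
  obtain ⟨c, hc⟩ := ha
  have h1 := φ.map_mul _ _ _ _ (φ.map_mul _ _ _ _ h hc) h
  have h2 := φ.map_mul _ _ _ _ (φ.map_mul _ _ _ _ hc h) hc
  rw [mul_inv_mul] at h1
  rw [inv_mul_inv] at h2
  rwa [← inv_unique _ _ (φ.map_unique h1 h) (φ.map_unique h2 hc)]

theorem mul_inv_mul_eq_iff (φ : IdealIso A) {a a' b b' : A} (h : b ∈ φ.toPEquiv a)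
    (h' : b' ∈ φ.toPEquiv a') : b * b⁻¹ * b' = b' ↔ a * a⁻¹ * a' = a' := by
  have h1 := φ.map_mul _ _ _ _ (φ.map_mul _ _ _ _ h (φ.map_inv h)) h'
  constructor
  · intro e
    rw [e] at h1
    exact φ.toPEquiv.inj h1 h'
  · intro e
    rw [e] at h1
    exact φ.map_unique h1 h'

end IdealIso

/-! ### Ideal isomorphisms implemented by conjugation in the middle term -/

namespace Extension

variable {A : Type u} {U : Type v} {G : Type w} [InverseSemigroup A] [InverseSemigroup U] [Group G]
  (E : Extension A U G)

theorem j_i (a : A) : E.j (E.i a) = 1 := (E.exact _).1 ⟨a, rfl⟩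

theorem i_mul_inv (a : A) : E.i (a * a⁻¹) = E.i a * (E.i a)⁻¹ := by
  rw [map_mul, InverseSemigroup.map_inv]

theorem i_idem (a : A) : IsIdempotentElem (E.i (a * a⁻¹)) :=
  InverseSemigroup.map_idem E.i (idem_mul_inv a)

theorem exists_idem {f : U} (hf : IsIdempotentElem f) :
    ∃ a : A, IsIdempotentElem a ∧ E.i a = f := by
  obtain ⟨a, rfl⟩ := (E.exact f).2 (map_idem_group E.j hf)
  exact ⟨a, E.injective (by rw [map_mul, hf.eq]), rfl⟩

theorem j_inv_mul_eq_one {u v : U} (hj : E.j u = E.j v) : E.j (u⁻¹ * v) = 1 := by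
  rw [map_mul, map_inv_group, hj, inv_mul_cancel]

theorem j_mul_inv_eq_one {u v : U} (hj : E.j u = E.j v) : E.j (u * v⁻¹) = 1 := by
  rw [map_mul, map_inv_group, hj, mul_inv_cancel]

/-- `φ` is given on its domain by conjugation with elements `c a` over `g`, which are compatible
with restriction. -/
structure Implements (g : G) (φ : IdealIso A) (c : A → U) : Prop where
  j_eq : ∀ a ∈ φ.dom, E.j (c a) = g
  inv_mul : ∀ a ∈ φ.dom, (c a)⁻¹ * c a = E.i (a * a⁻¹)
  apply_eq : ∀ a b, b ∈ φ.toPEquiv a → E.i b = c a * E.i a * (c a)⁻¹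
  restrict : ∀ a ∈ φ.dom, ∀ a' ∈ φ.dom, a * a⁻¹ * a' = a' → c a' = c a * E.i (a' * a'⁻¹)

variable [IsSemilatticeOfGroups A]

theorem idem_central {f : U} (hf : IsIdempotentElem f) (a : A) : f * E.i a = E.i a * f := by
  obtain ⟨e, he, rfl⟩ := E.exists_idem hf
  rw [← map_mul, IsSemilatticeOfGroups.idem_central he, map_mul]

/-- The element `x = u v⁻¹` lies over `1`, hence in `i(A)`, so `x x⁻¹ = x⁻¹ x`. The two sides reduce
to `u u⁻¹` and `v v⁻¹`. -/
theorem mul_inv_eq {u v : U} (hj : E.j u = E.j v) (h : u⁻¹ * u = v⁻¹ * v) :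
    u * u⁻¹ = v * v⁻¹ := by
  obtain ⟨a, ha⟩ := (E.exact _).2 (E.j_mul_inv_eq_one hj)
  have h1 : (u * v⁻¹) * (u * v⁻¹)⁻¹ = (u * v⁻¹)⁻¹ * (u * v⁻¹) := by
    rw [← ha, ← InverseSemigroup.map_inv, ← map_mul, ← map_mul,
      IsSemilatticeOfGroups.mul_inv_eq_inv_mul]
  rw [InverseSemigroup.mul_inv_rev, InverseSemigroup.inv_inv, mul_assoc, ← mul_assoc v⁻¹ v, ← h, mul_assoc u⁻¹ u,
    mul_inv_mul_assoc, mul_assoc v, ← mul_assoc u⁻¹, h, mul_assoc v⁻¹, mul_inv_mul_assoc] at h1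
  exact h1

theorem inv_mul_eq {u v : U} (hj : E.j u = E.j v) (h : u * u⁻¹ = v * v⁻¹) :
    u⁻¹ * u = v⁻¹ * v := by
  have := E.mul_inv_eq (u := u⁻¹) (v := v⁻¹) (by rw [map_inv_group, map_inv_group, hj])
    (by rwa [InverseSemigroup.inv_inv, InverseSemigroup.inv_inv])
  rwa [InverseSemigroup.inv_inv, InverseSemigroup.inv_inv] at this

namespace Implements

variable {E}
variable {g h : G} {φ ψ : IdealIso A} {c d : A → U}

theorem mul_inv (H : E.Implements g φ c) {a b : A} (hb : b ∈ φ.toPEquiv a) :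
    E.i (b * b⁻¹) = c a * (c a)⁻¹ := by
  have h1 : E.i b * (E.i b)⁻¹ =
      c a * (E.i a * (((c a)⁻¹ * c a) * ((E.i a)⁻¹ * (c a)⁻¹))) := by
    rw [H.apply_eq a b hb, InverseSemigroup.mul_inv_rev, InverseSemigroup.mul_inv_rev, InverseSemigroup.inv_inv]
    simp only [mul_assoc]
  rw [E.i_mul_inv, h1, H.inv_mul a ⟨b, hb⟩, ← mul_assoc (E.i (a * a⁻¹)),
    ← InverseSemigroup.map_inv, ← map_mul E.i (a * a⁻¹),
    IsSemilatticeOfGroups.mul_inv_eq_inv_mul a, inv_mul_inv, ← mul_assoc (E.i a), ← map_mul, ← H.inv_mul a ⟨b, hb⟩,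
    mul_assoc, mul_inv_mul_assoc]

/-- The composite is implemented by `a ↦ c (ψ a) * d a`; compatibility survives because `ψ`
preserves the restriction relation `a a⁻¹ a' = a'`. -/
theorem mul (H : E.Implements g φ c) (K : E.Implements h ψ d) :
    ∃ k, E.Implements (g * h) (φ * ψ) k := by
  have : ∀ a : A, ∃ b, a ∈ ψ.dom → b ∈ ψ.toPEquiv a := fun a => by
    by_cases ha : a ∈ ψ.dom
    · exact ⟨ha.choose, fun _ => ha.choose_spec⟩
    -- An arbitrary value, since `f` is only used on the domain of `ψ`.
    · exact ⟨a, fun h => (ha h).elim⟩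
  choose f hf using this
  have key : ∀ a ∈ (φ * ψ).dom, a ∈ ψ.dom ∧ f a ∈ φ.dom := by
    rintro a ⟨z, hz⟩
    obtain ⟨y, hy, hz⟩ := IdealIso.mem_mul.1 hz
    refine ⟨⟨y, hy⟩, ?_⟩
    rw [ψ.map_unique (hf a ⟨y, hy⟩) hy]
    exact ⟨z, hz⟩
  refine ⟨fun a => c (f a) * d a, ?_, ?_, ?_, ?_⟩
  · intro a ha
    rw [map_mul, H.j_eq _ (key a ha).2, K.j_eq _ (key a ha).1]
  · intro a ha
    rw [InverseSemigroup.mul_inv_rev, mul_assoc, ← mul_assoc (c (f a))⁻¹, H.inv_mul _ (key a ha).2,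
      K.mul_inv (hf a (key a ha).1), mul_inv_mul, K.inv_mul _ (key a ha).1]
  · intro a z hz
    obtain ⟨y, hy, hz'⟩ := IdealIso.mem_mul.1 hz
    have e := ψ.map_unique (hf a ⟨y, hy⟩) hy
    rw [e, H.apply_eq _ _ hz', K.apply_eq _ _ hy, InverseSemigroup.mul_inv_rev]
    simp only [mul_assoc]
  · intro a ha a' ha' h1
    have m := hf a (key a ha).1
    have m' := hf a' (key a' ha').1
    rw [H.restrict _ (key a ha).2 _ (key a' ha').2 ((ψ.mul_inv_mul_eq_iff m m').2 h1),
      K.mul_inv m', mul_assoc, mul_assoc (d a'), K.inv_mul _ (key a' ha').1,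
      K.restrict _ (key a ha).1 _ (key a' ha').1 h1, mul_assoc (d a), (E.i_idem a').eq, mul_assoc]

/-- The two images of `a` have the same idempotent by `mul_inv_eq`, and an ideal containing one
element contains its whole maximal subgroup. -/
theorem ran_le (H : E.Implements g φ c) (K : E.Implements g ψ d) (hdom : φ.dom = ψ.dom) :
    φ.ran ≤ ψ.ran := by
  rintro b ⟨a, hb⟩
  obtain ⟨b', hb'⟩ := hdom.le ⟨b, hb⟩
  have h1 : b * b⁻¹ = b' * b'⁻¹ := E.injective (by
    rw [H.mul_inv hb, K.mul_inv hb']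
    apply E.mul_inv_eq
    · rw [H.j_eq a ⟨b, hb⟩, K.j_eq a ⟨b', hb'⟩]
    · rw [H.inv_mul a ⟨b, hb⟩, K.inv_mul a ⟨b', hb'⟩])
  rw [← mul_inv_mul b, h1]
  exact (ψ.isIdeal_ran _ _ (ψ.isIdeal_ran _ _ ⟨a, hb'⟩).2).2

theorem sim (H : E.Implements g φ c) (K : E.Implements g ψ d) (hdom : φ.dom = ψ.dom) :
    IdealIso.Sim ψ φ := by
  refine ⟨hdom, le_antisymm (H.ran_le K hdom) (K.ran_le H hdom.symm), ?_⟩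
  -- The conjugating family: `p b` is the element `d a * (c a)⁻¹` over `1`, read in `A`, where `a`
  -- is the preimage of `b`.
  have ex : ∀ b : φ.ran, ∃ n a, (b : A) ∈ φ.toPEquiv a ∧ E.i n = d a * (c a)⁻¹ := by
    rintro ⟨b, a, hb⟩
    have ha : a ∈ φ.dom := ⟨b, hb⟩
    obtain ⟨n, hn⟩ := (E.exact _).2 (E.j_mul_inv_eq_one (u := d a) (v := c a)
      (by rw [H.j_eq a ha, K.j_eq a (hdom.le ha)]))
    exact ⟨n, a, hb, hn⟩
  choose p hp using ex
  have hp' : ∀ (b : φ.ran) (a : A), (b : A) ∈ φ.toPEquiv a → E.i (p b) = d a * (c a)⁻¹ := by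
    intro b a hb
    obtain ⟨a', hb', h1⟩ := hp b
    rwa [φ.toPEquiv.inj hb hb']
  have hc : ∀ a ∈ φ.dom, (c a)⁻¹ * c a = (d a)⁻¹ * d a := fun a ha => by
    rw [H.inv_mul a ha, K.inv_mul a (hdom.le ha)]
  have hfam : IsCompatibleFamily φ.ran p := by
    constructor
    · rintro ⟨b, a, hb⟩
      have ha : a ∈ φ.dom := ⟨b, hb⟩
      apply E.injective
      rw [E.i_mul_inv, hp' ⟨b, a, hb⟩ a hb, H.mul_inv hb, InverseSemigroup.mul_inv_rev, InverseSemigroup.inv_inv,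
        mul_assoc, ← mul_assoc (c a)⁻¹, hc a ha, mul_assoc, mul_inv_mul_assoc]
      exact E.mul_inv_eq (by rw [H.j_eq a ha, K.j_eq a (hdom.le ha)]) (hc a ha).symm
    · rintro ⟨b, a, hb⟩ ⟨b', a', hb'⟩ h1
      have ha : a ∈ φ.dom := ⟨b, hb⟩
      have ha' : a' ∈ φ.dom := ⟨b', hb'⟩
      have h2 := (φ.mul_inv_mul_eq_iff hb hb').1 h1
      apply E.injective
      rw [map_mul, hp' ⟨b, a, hb⟩ a hb, hp' ⟨b', a', hb'⟩ a' hb', H.mul_inv hb',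
        K.restrict a (hdom.le ha) a' (hdom.le ha') h2, H.restrict a ha a' ha' h2, InverseSemigroup.mul_inv_rev,
        inv_eq_of_idem (E.i_idem a')]
      simp only [mul_assoc]
      rw [idem_mul_self_mul (E.i_idem a'), ← mul_assoc (c a)⁻¹, hc a ha,
        idem_left_comm (idem_inv_mul _) (E.i_idem a'), ← hc a ha, mul_assoc, inv_mul_inv']
  -- Conjugating `c a c⁻¹` by `d c⁻¹` gives `d a d⁻¹`, because `c⁻¹ c = d⁻¹ d`.
  refine ⟨hfam.unit φ.isIdeal_ran, ?_⟩
  rintro a ⟨b, hb⟩ hab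
  change b ∈ φ.toPEquiv a at hab
  have ha : a ∈ φ.dom := ⟨b, hab⟩
  obtain ⟨b', hb'⟩ := hdom.le ha
  rw [hfam.conj_unit]
  convert hb'
  apply E.injective
  rw [map_mul, map_mul, InverseSemigroup.map_inv, hp' ⟨b, hb⟩ a hab, H.apply_eq a b hab,
    K.apply_eq a b' hb', InverseSemigroup.mul_inv_rev, InverseSemigroup.inv_inv]
  simp only [mul_assoc]
  rw [← mul_assoc (c a)⁻¹ (c a), hc a ha, ← mul_assoc (c a)⁻¹ (c a), hc a ha]
  simp only [mul_assoc]
  rw [inv_mul_inv', mul_inv_mul_assoc]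

end Implements

end Extension

theorem exists_pEquiv {X : Type u} {Y : Type v} (r : X → Y → Prop)
    (h : ∀ x y y', r x y → r x y' → y = y') (h' : ∀ x x' y, r x y → r x' y → x = x') :
    ∃ f : X ≃. Y, ∀ x y, y ∈ f x ↔ r x y := by
  classical
  let f : X → Option Y := fun x => if hx : ∃ y, r x y then some hx.choose else none
  let f' : Y → Option X := fun y => if hy : ∃ x, r x y then some hy.choose else none
  have hf : ∀ x y, y ∈ f x ↔ r x y := by
    intro x y
    by_cases hx : ∃ y, r x y
    · simp only [f, dif_pos hx, Option.mem_def, Option.some.injEq]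
      exact ⟨fun e => e ▸ hx.choose_spec, fun e => h _ _ _ hx.choose_spec e⟩
    · simp only [f, dif_neg hx, Option.mem_def, reduceCtorEq, false_iff]
      exact fun e => hx ⟨y, e⟩
  have hf' : ∀ x y, x ∈ f' y ↔ r x y := by
    intro x y
    by_cases hy : ∃ x, r x y
    · simp only [f', dif_pos hy, Option.mem_def, Option.some.injEq]
      exact ⟨fun e => e ▸ hy.choose_spec, fun e => h' _ _ _ hy.choose_spec e⟩
    · simp only [f', dif_neg hy, Option.mem_def, reduceCtorEq, false_iff]
      exact fun e => hy ⟨x, e⟩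
  exact ⟨⟨f, f', fun x y => (hf' x y).trans (hf x y).symm⟩, hf⟩

/-! ### Ordered retractions and their conjugation actions -/

namespace Extension

variable {A : Type u} {U : Type v} {G : Type w} [InverseSemigroup A] [InverseSemigroup U] [Group G]
  (E : Extension A U G)

/-- The composite of the projection `π : U → S` of a refinement with an order-preserving
transversal `ρ : S → U`, described in terms of the extension only. -/
structure IsOrderedRetraction (τ : U → U) : Prop where
  j_eq : ∀ u, E.j (τ u) = E.j u
  inv_mul : ∀ u, (τ u)⁻¹ * τ u = u⁻¹ * u
  eq_of : ∀ u v, E.j u = E.j v → u⁻¹ * u = v⁻¹ * v → τ u = τ v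
  mul_idem : ∀ u f, IsIdempotentElem f → τ (u * f) = τ u * f
  idem : ∀ f, IsIdempotentElem f → τ f = f

/-- `θ` is the partial action of `g` on `A` by conjugation with the elements `τ u` over `g`. -/
structure IsConjAction (τ : U → U) (g : G) (θ : IdealIso A) : Prop where
  mem_dom : ∀ a : A, a ∈ θ.dom ↔ ∃ u : U, E.j u = g ∧ u⁻¹ * u = E.i (a * a⁻¹)
  mem_ran : ∀ b : A, b ∈ θ.ran ↔ ∃ u : U, E.j u = g ∧ u * u⁻¹ = E.i (b * b⁻¹)
  apply_eq : ∀ (u : U) (a b : A), E.j u = g → u⁻¹ * u = E.i (a * a⁻¹) → b ∈ θ.toPEquiv a →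
    E.i b = τ u * E.i a * (τ u)⁻¹

variable {E} {τ : U → U}

theorem IsOrderedRetraction.mul_i (hτ : E.IsOrderedRetraction τ) {u : U} {a : A} (h : u⁻¹ * u = E.i (a * a⁻¹)) :
    (τ u)⁻¹ * (τ u * E.i a) = E.i a := by
  rw [← mul_assoc, hτ.inv_mul, h, ← map_mul, mul_inv_mul]

/-- Any `u` over `g` with `u⁻¹ u = a a⁻¹` supplies `τ u` as the conjugator at `a`. Independence of
`u` (`eq_of`) and `mul_idem` make these choices compatible with restriction. -/
theorem IsConjAction.implements {g : G} {θ : IdealIso A} (h : E.IsConjAction τ g θ)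
    (hτ : E.IsOrderedRetraction τ) : ∃ c, E.Implements g θ c := by
  have : ∀ a : A, ∃ u, a ∈ θ.dom → E.j u = g ∧ u⁻¹ * u = E.i (a * a⁻¹) := fun a => by
    by_cases ha : a ∈ θ.dom
    · obtain ⟨u, hu⟩ := (h.mem_dom a).1 ha
      exact ⟨u, fun _ => hu⟩
    · exact ⟨E.i a, fun h => (ha h).elim⟩
  choose c hc using this
  refine ⟨fun a => τ (c a), ?_, ?_, ?_, ?_⟩
  · intro a ha
    rw [hτ.j_eq, (hc a ha).1]
  · intro a ha
    rw [hτ.inv_mul, (hc a ha).2]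
  · intro a b hb
    have := hc a ⟨b, hb⟩
    exact h.apply_eq _ _ _ this.1 this.2 hb
  · intro a ha a' ha' e
    rw [← hτ.mul_idem _ _ (E.i_idem a')]
    apply hτ.eq_of
    · rw [map_mul, E.j_i, mul_one, (hc a ha).1, (hc a' ha').1]
    · rw [InverseSemigroup.mul_inv_rev, inv_eq_of_idem (E.i_idem a'), mul_assoc,
        ← mul_assoc (c a)⁻¹, (hc a ha).2, (hc a' ha').2, ← map_mul, ← mul_assoc (a * a⁻¹), e,
        (E.i_idem a').eq]

theorem IsConjAction.mem_dom_iff_of_eq {g : G} {θ : IdealIso A} (hθ : E.IsConjAction τ g θ)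
    {u : U} {f : A} (hf : E.i f = u * u⁻¹) :
    f ∈ θ.dom ↔ ∃ v : U, E.j v = g ∧ v⁻¹ * v = u * u⁻¹ := by
  rw [hθ.mem_dom, E.i_mul_inv, hf, InverseSemigroup.mul_inv_rev, InverseSemigroup.inv_inv,
    (idem_mul_inv u).eq]

variable [IsSemilatticeOfGroups A]

namespace IsOrderedRetraction

theorem mul_inv (hτ : E.IsOrderedRetraction τ) (u : U) : τ u * (τ u)⁻¹ = u * u⁻¹ :=
  E.mul_inv_eq (hτ.j_eq u) (hτ.inv_mul u)

theorem i_mul (hτ : E.IsOrderedRetraction τ) {u : U} {a : A} (h : u⁻¹ * u = E.i (a * a⁻¹)) :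
    E.i a * ((τ u)⁻¹ * τ u) = E.i a := by
  rw [hτ.inv_mul, h, ← map_mul, IsSemilatticeOfGroups.mul_inv_eq_inv_mul, mul_inv_mul']

theorem conj_mul_inv (hτ : E.IsOrderedRetraction τ) {u : U} {a b : A}
    (h : u⁻¹ * u = E.i (a * a⁻¹)) (hb : E.i b = τ u * E.i a * (τ u)⁻¹) :
    E.i (b * b⁻¹) = u * u⁻¹ := by
  rw [E.i_mul_inv, hb, InverseSemigroup.mul_inv_rev, InverseSemigroup.mul_inv_rev,
    InverseSemigroup.inv_inv]
  calc _ = τ u * (E.i a * ((τ u)⁻¹ * τ u) * (E.i a)⁻¹) * (τ u)⁻¹ := by simp only [mul_assoc]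
    _ = τ u * ((τ u)⁻¹ * τ u) * (τ u)⁻¹ := by
      rw [hτ.i_mul h, ← E.i_mul_inv, ← h, hτ.inv_mul]
    _ = u * u⁻¹ := by rw [mul_inv_mul', hτ.mul_inv]

/-- Cut down to their common domain, `u` and `u'` have the same `τ`. Hence the inner factor `(τ u)⁻¹
* τ u'`, which lies in `i(A)`, is the idempotent `a a⁻¹ a' a'⁻¹` and is absorbed by `a` and `a'`. -/
theorem conj_mul (hτ : E.IsOrderedRetraction τ) {u u' : U} {a a' : A} (hj : E.j u = E.j u')
    (h : u⁻¹ * u = E.i (a * a⁻¹)) (h' : u'⁻¹ * u' = E.i (a' * a'⁻¹)) :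
    (τ u * E.i a * (τ u)⁻¹) * (τ u' * E.i a' * (τ u')⁻¹) =
      τ (u * E.i (a' * a'⁻¹)) * E.i (a * a') * (τ (u * E.i (a' * a'⁻¹)))⁻¹ := by
  have hw : τ (u * E.i (a' * a'⁻¹)) = τ (u' * E.i (a * a⁻¹)) := by
    apply hτ.eq_of
    · rw [map_mul, map_mul E.j u', E.j_i, E.j_i, hj]
    · rw [InverseSemigroup.mul_inv_rev, InverseSemigroup.mul_inv_rev,
        inv_eq_of_idem (E.i_idem a), inv_eq_of_idem (E.i_idem a')]
      simp only [mul_assoc]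
      rw [← mul_assoc u⁻¹ u, ← mul_assoc u'⁻¹ u', h, h', idem_comm (E.i_idem a) (E.i_idem a'),
        idem_mul_self_mul (E.i_idem a'), idem_comm (E.i_idem a') (E.i_idem a),
        idem_mul_self_mul (E.i_idem a)]
  have hw' : τ u * E.i (a' * a'⁻¹) = τ u' * E.i (a * a⁻¹) := by
    rw [← hτ.mul_idem _ _ (E.i_idem a'), hw, hτ.mul_idem _ _ (E.i_idem a)]
  obtain ⟨c, hc⟩ := (E.exact _).2 (E.j_inv_mul_eq_one (u := τ u) (v := τ u')
    (by rw [hτ.j_eq, hτ.j_eq, hj]))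
  have hc1 : E.i c = E.i (a * a⁻¹) * E.i (a' * a'⁻¹) := by
    have h1 : E.i c = E.i c * E.i (a * a⁻¹) := by
      rw [← E.idem_central (E.i_idem a), hc, ← h, ← hτ.inv_mul, ← mul_assoc, inv_mul_inv]
    rw [h1, hc, mul_assoc, ← hw', ← mul_assoc, hτ.inv_mul, h]
  calc _ = τ u * E.i a * ((τ u)⁻¹ * τ u') * E.i a' * (τ u')⁻¹ := by simp only [mul_assoc]
    _ = τ u * (E.i a * (E.i (a * a⁻¹) * E.i (a' * a'⁻¹)) * E.i a') * (τ u')⁻¹ := by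
      rw [← hc, hc1]; simp only [mul_assoc]
    _ = τ u * (E.i (a' * a'⁻¹) * (E.i (a * a') * E.i (a * a⁻¹))) * (τ u')⁻¹ := by
      have ha : a * (a * a⁻¹) = a := by
        rw [IsSemilatticeOfGroups.mul_inv_eq_inv_mul, mul_inv_mul']
      have h1 : a * (a * a⁻¹ * (a' * a'⁻¹)) * a' = a * a' := by
        rw [← mul_assoc a, ha, mul_assoc, mul_inv_mul]
      have h2 : a' * a'⁻¹ * (a * a' * (a * a⁻¹)) = a * a' := by
        rw [← IsSemilatticeOfGroups.idem_central (idem_mul_inv a), ← mul_assoc (a * a⁻¹),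
          mul_inv_mul, ← mul_assoc, IsSemilatticeOfGroups.idem_central (idem_mul_inv a'),
          mul_assoc, mul_inv_mul]
      rw [← map_mul, ← map_mul, ← map_mul, ← map_mul, ← map_mul, h1, h2]
    _ = _ := by
      -- The left conjugator is written as a restriction of `u`, the right one as a restriction of
      -- `u'`.
      nth_rewrite 2 [hw]
      rw [hτ.mul_idem _ _ (E.i_idem a), hτ.mul_idem _ _ (E.i_idem a'),
        InverseSemigroup.mul_inv_rev, inv_eq_of_idem (E.i_idem a)]
      simp only [mul_assoc]

theorem exists_isConjAction (hτ : E.IsOrderedRetraction τ) (g : G) :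
    ∃ θ, E.IsConjAction τ g θ := by
  -- Multiplying `u` by an idempotent from `A` keeps it over `g` and shrinks its domain; this is why
  -- the domain is an ideal.
  have shrink : ∀ (u : U) (e f : A), u⁻¹ * u = E.i (e * e⁻¹) →
      (u * E.i (f * f⁻¹))⁻¹ * (u * E.i (f * f⁻¹)) = E.i (e * f * (e * f)⁻¹) := by
    intro u e f h
    rw [InverseSemigroup.mul_inv_rev, inv_eq_of_idem (E.i_idem f), mul_assoc, ← mul_assoc u⁻¹, h,
      idem_comm (E.i_idem e) (E.i_idem f), idem_mul_self_mul (E.i_idem f),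
      IsSemilatticeOfGroups.mul_mul_inv, map_mul E.i (e * e⁻¹),
      idem_comm (E.i_idem f) (E.i_idem e)]
  have comm : ∀ e f : A, e * f * (e * f)⁻¹ = f * e * (f * e)⁻¹ := fun e f => by
    rw [IsSemilatticeOfGroups.mul_mul_inv, IsSemilatticeOfGroups.mul_mul_inv,
      idem_comm (idem_mul_inv e) (idem_mul_inv f)]
  have hdom : ∀ (g : G) (a x : A), (∃ u : U, E.j u = g ∧ u⁻¹ * u = E.i (x * x⁻¹)) →
      (∃ u : U, E.j u = g ∧ u⁻¹ * u = E.i (a * x * (a * x)⁻¹)) ∧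
      (∃ u : U, E.j u = g ∧ u⁻¹ * u = E.i (x * a * (x * a)⁻¹)) := by
    rintro g a x ⟨u, hu, h⟩
    have h1 : E.j (u * E.i (a * a⁻¹)) = g := by rw [map_mul, E.j_i, mul_one, hu]
    have h2 := shrink u x a h
    exact ⟨⟨_, h1, by rw [h2, comm]⟩, ⟨_, h1, h2⟩⟩
  have hran : ∀ (a x : A), (∃ u : U, E.j u = g ∧ u * u⁻¹ = E.i (x * x⁻¹)) →
      (∃ u : U, E.j u = g ∧ u * u⁻¹ = E.i (a * x * (a * x)⁻¹)) ∧
      (∃ u : U, E.j u = g ∧ u * u⁻¹ = E.i (x * a * (x * a)⁻¹)) := by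
    rintro a x ⟨u, hu, h⟩
    -- The range over `g` is the domain over `g⁻¹`, via `u ↦ u⁻¹`.
    obtain ⟨⟨v, hv, h1⟩, ⟨w, hw, h2⟩⟩ := hdom g⁻¹ a x
      ⟨u⁻¹, by rw [map_inv_group, hu], by rw [InverseSemigroup.inv_inv, h]⟩
    exact ⟨⟨v⁻¹, by rw [map_inv_group, hv, _root_.inv_inv], by rw [InverseSemigroup.inv_inv, h1]⟩,
      ⟨w⁻¹, by rw [map_inv_group, hw, _root_.inv_inv], by rw [InverseSemigroup.inv_inv, h2]⟩⟩
  let r : A → A → Prop := fun a b =>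
    ∃ u : U, E.j u = g ∧ u⁻¹ * u = E.i (a * a⁻¹) ∧ E.i b = τ u * E.i a * (τ u)⁻¹
  obtain ⟨θ, hθ⟩ := exists_pEquiv r (by
    rintro a b b' ⟨u, hu, h, hb⟩ ⟨u', hu', h', hb'⟩
    apply E.injective
    rw [hb, hb', hτ.eq_of u u' (hu.trans hu'.symm) (h.trans h'.symm)]) (by
    rintro a a' b ⟨u, hu, h, hb⟩ ⟨u', hu', h', hb'⟩
    -- Equal images force equal range idempotents, hence equal domain idempotents; so both
    -- conjugations use the same `τ u` and can be undone.
    have e1 : u * u⁻¹ = u' * u'⁻¹ := by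
      rw [← hτ.conj_mul_inv h hb, ← hτ.conj_mul_inv h' hb']
    have e2 := hτ.eq_of u u' (hu.trans hu'.symm) (E.inv_mul_eq (hu.trans hu'.symm) e1)
    have inv : ∀ {u : U} {a : A}, u⁻¹ * u = E.i (a * a⁻¹) → E.i b = τ u * E.i a * (τ u)⁻¹ →
        E.i a = (τ u)⁻¹ * E.i b * τ u := by
      intro u a h hb
      rw [hb]
      simp only [mul_assoc]
      rw [hτ.i_mul h, hτ.mul_i h]
    apply E.injective
    rw [inv h hb, inv h' hb', e2])
  have hr : ∀ a, (∃ b, r a b) ↔ ∃ u : U, E.j u = g ∧ u⁻¹ * u = E.i (a * a⁻¹) := by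
    intro a
    constructor
    · rintro ⟨b, u, hu, h, _⟩
      exact ⟨u, hu, h⟩
    · rintro ⟨u, hu, h⟩
      obtain ⟨b, hb⟩ := (E.exact (τ u * E.i a * (τ u)⁻¹)).2 (by
        rw [map_mul, map_mul, map_inv_group, E.j_i, mul_one, mul_inv_cancel])
      exact ⟨b, u, hu, h, hb⟩
  have hr' : ∀ b, (∃ a, r a b) ↔ ∃ u : U, E.j u = g ∧ u * u⁻¹ = E.i (b * b⁻¹) := by
    intro b
    constructor
    · rintro ⟨a, u, hu, h, hb⟩
      exact ⟨u, hu, (hτ.conj_mul_inv h hb).symm⟩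
    · rintro ⟨u, hu, h⟩
      obtain ⟨a, ha⟩ := (E.exact ((τ u)⁻¹ * E.i b * τ u)).2 (by
        rw [map_mul, map_mul, map_inv_group, E.j_i, mul_one, inv_mul_cancel])
      have e1 : τ u * (τ u)⁻¹ * E.i b = E.i b := by
        rw [hτ.mul_inv, h, ← map_mul, mul_inv_mul]
      have e2 : E.i b * (τ u * (τ u)⁻¹) = E.i b := by
        rw [← E.idem_central (idem_mul_inv _), e1]
      refine ⟨a, u, hu, ?_, ?_⟩
      · rw [E.i_mul_inv, ha, InverseSemigroup.mul_inv_rev, InverseSemigroup.mul_inv_rev,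
          InverseSemigroup.inv_inv]
        calc u⁻¹ * u = (τ u)⁻¹ * τ u := (hτ.inv_mul u).symm
          _ = (τ u)⁻¹ * (E.i b * (E.i b)⁻¹) * τ u := by
            rw [← E.i_mul_inv, ← h, ← hτ.mul_inv, inv_mul_inv']
          _ = (τ u)⁻¹ * (E.i b * (τ u * (τ u)⁻¹) * (E.i b)⁻¹) * τ u := by rw [e2]
          _ = _ := by simp only [mul_assoc]
      · rw [ha]
        calc E.i b = τ u * (τ u)⁻¹ * E.i b * (τ u * (τ u)⁻¹) := by rw [e1, e2]
          _ = _ := by simp only [mul_assoc]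
  refine ⟨⟨θ, ?_, ?_, ?_⟩, ?_, ?_, ?_⟩
  · intro a x y hy
    simp only [hθ, hr]
    exact hdom g a x ((hr x).1 ⟨y, (hθ _ _).1 hy⟩)
  · intro a x y hy
    simp only [hθ, hr']
    exact hran a y ((hr' y).1 ⟨x, (hθ _ _).1 hy⟩)
  · intro x x' y y' hy hy'
    rw [hθ] at hy hy' ⊢
    obtain ⟨u, hu, h, hb⟩ := hy
    obtain ⟨u', hu', h', hb'⟩ := hy'
    refine ⟨u * E.i (x' * x'⁻¹), by rw [map_mul, E.j_i, mul_one, hu], shrink u x x' h, ?_⟩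
    rw [map_mul, hb, hb', hτ.conj_mul (hu.trans hu'.symm) h h']
  · intro a
    rw [← hr]
    exact exists_congr fun b => hθ a b
  · intro b
    rw [← hr']
    exact exists_congr fun a => hθ a b
  · intro u a b hu h hb
    obtain ⟨u', hu', h', hb'⟩ := (hθ a b).1 hb
    rw [hb', hτ.eq_of u u' (hu.trans hu'.symm) (h.trans h'.symm)]

end IsOrderedRetraction

/-- The domain is described without the retraction, so `Implements.sim` applies directly. -/
theorem IsConjAction.mk_eq {τ' : U → U} {g : G} {θ θ' : IdealIso A} (h : E.IsConjAction τ g θ)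
    (h' : E.IsConjAction τ' g θ') (hτ : E.IsOrderedRetraction τ)
    (hτ' : E.IsOrderedRetraction τ') : Varsigma.mk θ = Varsigma.mk θ' := by
  obtain ⟨c, hc⟩ := h.implements hτ
  obtain ⟨d, hd⟩ := h'.implements hτ'
  refine Quotient.sound (hd.sim hc (SetLike.ext fun a => ?_))
  rw [h.mem_dom, h'.mem_dom]

/-- The image of `a` under `θ` lies in the ideal `φ.dom` exactly when its idempotent, `u u⁻¹`, does.
This turns domains of composites into chains of composable elements of `U`. -/
theorem IsConjAction.mem_dom_mul {h : G} {φ θ : IdealIso A} (hθ : E.IsConjAction τ h θ)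
    (hτ : E.IsOrderedRetraction τ) (a : A) : a ∈ (φ * θ).dom ↔
      ∃ (u : U) (f : A), E.j u = h ∧ u⁻¹ * u = E.i (a * a⁻¹) ∧ E.i f = u * u⁻¹ ∧ f ∈ φ.dom := by
  constructor
  · rintro ⟨z, hz⟩
    obtain ⟨y, hy, hz⟩ := IdealIso.mem_mul.1 hz
    obtain ⟨u, hu, hu'⟩ := (hθ.mem_dom a).1 ⟨y, hy⟩
    exact ⟨u, y * y⁻¹, hu, hu', hτ.conj_mul_inv hu' (hθ.apply_eq u a y hu hu' hy),
      (φ.isIdeal_dom y⁻¹ y ⟨z, hz⟩).2⟩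
  · rintro ⟨u, f, hu, hu', hf, hf'⟩
    obtain ⟨y, hy⟩ := (hθ.mem_dom a).2 ⟨u, hu, hu'⟩
    have h1 := hτ.conj_mul_inv hu' (hθ.apply_eq u a y hu hu' hy)
    rw [← hf] at h1
    have h2 : y ∈ φ.dom := by
      rw [← mul_inv_mul y, E.injective h1]
      exact (φ.isIdeal_dom y f hf').2
    obtain ⟨z, hz⟩ := h2
    exact ⟨z, IdealIso.mem_mul.2 ⟨y, hy, hz⟩⟩

/-- At `a` the idempotent `a a⁻¹` can serve as `u`; `τ` fixes it, and conjugation by it fixes `a`.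
-/
theorem IsConjAction.one {θ : IdealIso A} (hθ : E.IsConjAction τ 1 θ)
    (hτ : E.IsOrderedRetraction τ) : θ = 1 := by
  have h : ∀ a, a ∈ θ.toPEquiv a := by
    intro a
    have h1 : (E.i (a * a⁻¹))⁻¹ * E.i (a * a⁻¹) = E.i (a * a⁻¹) := by
      rw [inv_eq_of_idem (E.i_idem a), (E.i_idem a).eq]
    obtain ⟨b, hb⟩ := (hθ.mem_dom a).2 ⟨E.i (a * a⁻¹), E.j_i _, h1⟩
    have h2 := hθ.apply_eq _ a b (E.j_i _) h1 hb
    rw [hτ.idem _ (E.i_idem a), inv_eq_of_idem (E.i_idem a), ← map_mul, mul_inv_mul, ← map_mul,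
      IsSemilatticeOfGroups.mul_inv_eq_inv_mul, mul_inv_mul'] at h2
    rwa [E.injective h2] at hb
  apply IdealIso.ext
  apply PEquiv.ext
  intro a
  exact h a

theorem IsOrderedRetraction.isUnitalPartialHom (hτ : E.IsOrderedRetraction τ)
    {θ : G → IdealIso A} (hθ : ∀ g, E.IsConjAction τ g (θ g)) :
    IsUnitalPartialHom fun g => Varsigma.mk (θ g) := by
  choose c hc using fun g => (hθ g).implements hτ
  refine ⟨fun g h => ?_, fun g h => ?_, ?_⟩
  · change Varsigma.mk (θ g⁻¹ * θ g * θ h) = Varsigma.mk (θ g⁻¹ * θ (g * h))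
    obtain ⟨k, hk⟩ := (hc g⁻¹).mul (hc g)
    obtain ⟨k₁, hk₁⟩ := hk.mul (hc h)
    obtain ⟨k₂, hk₂⟩ := (hc g⁻¹).mul (hc (g * h))
    rw [← mul_assoc, inv_mul_cancel, one_mul] at hk₂
    rw [inv_mul_cancel, one_mul] at hk₁
    -- Both composites are implemented over `h`, so only their domains remain to be compared.
    refine Quotient.sound (hk₂.sim hk₁ (SetLike.ext fun a => ?_))
    rw [(hθ h).mem_dom_mul hτ, (hθ (g * h)).mem_dom_mul hτ]
    constructor
    -- With `z` over `g h` followed by `w` over `g⁻¹`, the chain `w z`, `w⁻¹`, `w` lies over `h`,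
    -- `g`, `g⁻¹` and starts at the same idempotent.
    · rintro ⟨z, f, hz, hz', hf, hf'⟩
      obtain ⟨w, hw, hw'⟩ := ((hθ g⁻¹).mem_dom_iff_of_eq hf).1 hf'
      have e1 : (w * z)⁻¹ * (w * z) = z⁻¹ * z := by
        rw [InverseSemigroup.mul_inv_rev, mul_assoc, ← mul_assoc w⁻¹, hw', mul_inv_mul]
      have e2 : (w * z) * (w * z)⁻¹ = w * w⁻¹ := by
        rw [InverseSemigroup.mul_inv_rev, mul_assoc, ← mul_assoc z, ← hw', inv_mul_inv]
      obtain ⟨f', hf1, hf2⟩ := E.exists_idem (idem_mul_inv (w * z))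
      refine ⟨w * z, f', by rw [map_mul, hw, hz, inv_mul_cancel_left], e1.trans hz', hf2, ?_⟩
      rw [(hθ g).mem_dom_mul hτ]
      refine ⟨w⁻¹, f, by rw [map_inv_group, hw, _root_.inv_inv], ?_, ?_, hf'⟩
      · rw [InverseSemigroup.inv_inv, inv_eq_of_idem hf1, hf1.eq, hf2, e2]
      · rw [InverseSemigroup.inv_inv, hf, hw']
    · rintro ⟨u, f, hu, hu', hf, hf'⟩
      obtain ⟨v, f', hv, hv', hf1, hf2⟩ := ((hθ g).mem_dom_mul hτ f).1 hf'
      rw [E.i_mul_inv, hf, InverseSemigroup.mul_inv_rev, InverseSemigroup.inv_inv,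
        (idem_mul_inv u).eq] at hv'
      have e2 : (v * u) * (v * u)⁻¹ = v * v⁻¹ := by
        rw [InverseSemigroup.mul_inv_rev, mul_assoc, ← mul_assoc u, ← hv', inv_mul_inv]
      refine ⟨v * u, f', by rw [map_mul, hv, hu], ?_, by rw [hf1, e2], hf2⟩
      rw [InverseSemigroup.mul_inv_rev, mul_assoc, ← mul_assoc v⁻¹, hv', mul_inv_mul, hu']
  · change Varsigma.mk (θ g * θ h * θ h⁻¹) = Varsigma.mk (θ (g * h) * θ h⁻¹)
    obtain ⟨k, hk⟩ := (hc g).mul (hc h)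
    obtain ⟨k₁, hk₁⟩ := hk.mul (hc h⁻¹)
    obtain ⟨k₂, hk₂⟩ := (hc (g * h)).mul (hc h⁻¹)
    refine Quotient.sound (hk₂.sim hk₁ (SetLike.ext fun a => ?_))
    rw [(hθ h⁻¹).mem_dom_mul hτ, (hθ h⁻¹).mem_dom_mul hτ]
    refine exists_congr fun u => exists_congr fun f => and_congr_right fun hu =>
      and_congr_right fun hu' => and_congr_right fun hf => ?_
    rw [(hθ (g * h)).mem_dom_iff_of_eq hf, (hθ h).mem_dom_mul hτ]
    have hff : E.i (f * f⁻¹) = u * u⁻¹ := by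
      rw [E.i_mul_inv, hf, InverseSemigroup.mul_inv_rev, InverseSemigroup.inv_inv,
        (idem_mul_inv u).eq]
    constructor
    -- Here `u` lies over `h⁻¹` and `z` over `g h`; after `u`, the element `z` is replaced by `u⁻¹`
    -- over `h` followed by `z u` over `g`.
    · rintro ⟨z, hz, hz'⟩
      have e1 : (u⁻¹) * (u⁻¹)⁻¹ = (z * u)⁻¹ * (z * u) := by
        rw [InverseSemigroup.inv_inv, InverseSemigroup.mul_inv_rev, mul_assoc, ← mul_assoc z⁻¹,
          hz', mul_inv_mul]
      obtain ⟨f', hf1, hf2⟩ := E.exists_idem (idem_mul_inv u⁻¹)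
      refine ⟨u⁻¹, f', by rw [map_inv_group, hu, _root_.inv_inv], ?_, hf2, ?_⟩
      · rw [InverseSemigroup.inv_inv, hff]
      · rw [(hθ g).mem_dom_iff_of_eq hf2]
        exact ⟨z * u, by rw [map_mul, hz, hu, mul_inv_cancel_right], e1.symm⟩
    · rintro ⟨v, f', hv, hv', hf1, hf2⟩
      obtain ⟨w, hw, hw'⟩ := ((hθ g).mem_dom_iff_of_eq hf1).1 hf2
      refine ⟨w * v, by rw [map_mul, hw, hv], ?_⟩
      rw [InverseSemigroup.mul_inv_rev, mul_assoc, ← mul_assoc w⁻¹, hw', mul_inv_mul, hv', hff]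
  · change Varsigma.mk (θ 1) = Varsigma.mk 1
    rw [(hθ 1).one hτ]

end Extension

/-! ### From refinements with transversals to ordered retractions -/

namespace Extension

variable {A : Type u} {U : Type v} {G : Type w} [InverseSemigroup A] [InverseSemigroup U] [Group G]
  {E : Extension A U G}

namespace Refinement

variable {S : Type y} [InverseSemigroup S] {R : E.Refinement S} {ρ : S → U}

theorem IsOrderPreservingTransversal.map_idem_eq (hρ : R.IsOrderPreservingTransversal ρ) {f : U}
    (hf : IsIdempotentElem f) : ρ (R.π f) = f :=
  R.isExtension.separating _ _
    (hρ.map_idempotent _ (InverseSemigroup.map_idem R.π hf)) hf (hρ.section_eq _)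

theorem IsOrderPreservingTransversal.map_inv_mul (hρ : R.IsOrderPreservingTransversal ρ) (u : U) :
    ρ ((R.π u)⁻¹ * R.π u) = u⁻¹ * u := by
  rw [← InverseSemigroup.map_inv, ← map_mul, hρ.map_idem_eq (idem_inv_mul u)]

theorem IsOrderPreservingTransversal.map_mul_inv (hρ : R.IsOrderPreservingTransversal ρ) (u : U) :
    ρ (R.π u * (R.π u)⁻¹) = u * u⁻¹ := by
  rw [← InverseSemigroup.map_inv, ← map_mul, hρ.map_idem_eq (idem_mul_inv u)]

/-- The element `u v⁻¹` lies over `1`, hence in `i(A)`, so its image in `S` is idempotent. Thus `π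
u` lies below `π v` with the same domain idempotent, which forces equality. -/
theorem π_eq_of (R : E.Refinement S) {u v : U} (hj : E.j u = E.j v) (h : u⁻¹ * u = v⁻¹ * v) :
    R.π u = R.π v := by
  have hx : IsIdempotentElem (R.π (u * v⁻¹)) :=
    (R.isExtension.exact _).1 ((E.exact _).2 (E.j_mul_inv_eq_one hj))
  have h1 : R.π (u * v⁻¹) * R.π v = R.π u := by
    rw [← map_mul, mul_assoc, ← h, mul_inv_mul']
  have h2 : (R.π v)⁻¹ * (R.π (u * v⁻¹) * R.π v) = (R.π v)⁻¹ * R.π v := by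
    have h3 : (R.π u)⁻¹ * R.π u = (R.π v)⁻¹ * R.π v := by
      rw [← InverseSemigroup.map_inv, ← map_mul, h, map_mul, InverseSemigroup.map_inv]
    rw [← h3, ← h1, InverseSemigroup.mul_inv_rev, inv_eq_of_idem hx, mul_assoc,
      idem_mul_self_mul hx]
  calc R.π u = R.π (u * v⁻¹) * (R.π v * ((R.π v)⁻¹ * R.π v)) := by rw [mul_inv_mul', h1]
    _ = R.π v * ((R.π v)⁻¹ * (R.π (u * v⁻¹) * R.π v)) := by
      rw [← mul_assoc (R.π v), ← mul_assoc, idem_comm hx (idem_mul_inv _)]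
      simp only [mul_assoc]
    _ = R.π v := by rw [h2, mul_inv_mul']

theorem IsOrderPreservingTransversal.isOrderedRetraction
    (hρ : R.IsOrderPreservingTransversal ρ) : E.IsOrderedRetraction fun u => ρ (R.π u) := by
  have inv_mul : ∀ u, (ρ (R.π u))⁻¹ * ρ (R.π u) = u⁻¹ * u := by
    intro u
    rw [← hρ.map_inv_mul, hρ.section_eq, hρ.map_inv_mul]
  refine ⟨?_, inv_mul, ?_, ?_, fun f hf => hρ.map_idem_eq hf⟩
  · intro u
    rw [← R.comp, ← R.comp, hρ.section_eq]
  · intro u v hj h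
    rw [R.π_eq_of hj h]
  · intro u f hf
    -- Order preservation enters here: an element below `τ u` is `τ u` times its own domain
    -- idempotent.
    have h1 : NatLE (ρ (R.π (u * f))) (ρ (R.π u)) := by
      apply hρ.monotone
      rw [map_mul]
      exact natLE_mul_idem _ (InverseSemigroup.map_idem R.π hf)
    rw [eq_mul_of_natLE h1, inv_mul, InverseSemigroup.mul_inv_rev, inv_eq_of_idem hf, mul_assoc f,
      ← mul_assoc u⁻¹, idem_left_comm hf (idem_inv_mul u), hf.eq, ← mul_assoc, ← inv_mul u,
      mul_inv_mul']

/-- Every `s` is some `π u`, and `ρ` sends the idempotents of `π u` to those of `u`; so `S` can be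
eliminated. -/
theorem IsOrderPreservingTransversal.induces_iff (hρ : R.IsOrderPreservingTransversal ρ) {g : G}
    {θ : IdealIso A} : R.Induces ρ g θ ↔ E.IsConjAction (fun u => ρ (R.π u)) g θ := by
  have h1 : ∀ a : A, (∃ s, R.κ s = g ∧ ρ (s⁻¹ * s) = E.i (a * a⁻¹)) ↔
      ∃ u, E.j u = g ∧ u⁻¹ * u = E.i (a * a⁻¹) := fun a => by
    rw [R.isExtension.surjective.exists]
    simp only [R.comp, hρ.map_inv_mul]
  have h2 : ∀ a : A, (∃ s, R.κ s = g ∧ ρ (s * s⁻¹) = E.i (a * a⁻¹)) ↔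
      ∃ u, E.j u = g ∧ u * u⁻¹ = E.i (a * a⁻¹) := fun a => by
    rw [R.isExtension.surjective.exists]
    simp only [R.comp, hρ.map_mul_inv]
  constructor
  · rintro ⟨hd, hr, ha⟩
    refine ⟨fun a => (hd a).trans (h1 a), fun a => (hr a).trans (h2 a),
      fun u a b hu h hb => ha (R.π u) a b ?_ ?_ hb⟩
    · rw [R.comp, hu]
    · rw [hρ.map_inv_mul, h]
  · rintro ⟨hd, hr, ha⟩
    refine ⟨fun a => (hd a).trans (h1 a).symm, fun a => (hr a).trans (h2 a).symm,
      fun s a b hu h hb => ?_⟩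
    obtain ⟨u, rfl⟩ := R.isExtension.surjective s
    rw [R.comp] at hu
    rw [hρ.map_inv_mul] at h
    exact ha u a b hu h hb

theorem IsOrderPreservingTransversal.isAbstractKernel_iff [IsSemilatticeOfGroups A]
    (hρ : R.IsOrderPreservingTransversal ρ) {τ : U → U} (hτ : E.IsOrderedRetraction τ)
    {θ : G → IdealIso A} (hθ : ∀ g, E.IsConjAction τ g (θ g)) (φ : G → Varsigma A) :
    R.IsAbstractKernel ρ φ ↔ φ = fun g => Varsigma.mk (θ g) := by
  constructor
  · intro h
    funext g
    obtain ⟨θ', h', e⟩ := h g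
    rw [e]
    exact (hρ.induces_iff.1 h').mk_eq (hθ g) hρ.isOrderedRetraction hτ
  · rintro rfl g
    obtain ⟨θ', h'⟩ := hρ.isOrderedRetraction.exists_isConjAction g
    exact ⟨θ', hρ.induces_iff.2 h', (hθ g).mk_eq h' hτ hρ.isOrderedRetraction⟩

/-! ### Transport of refinements along an equivalence -/

section Transport

variable {U' : Type x} [InverseSemigroup U'] {E' : Extension A U' G} (μ : U ≃* U')

theorem mulEquiv_idem_iff (z : U) : IsIdempotentElem (μ z) ↔ IsIdempotentElem z := by
  rw [IsIdempotentElem, IsIdempotentElem, ← map_mul, μ.injective.eq_iff]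

theorem mulEquiv_map_inv (z : U) : μ z⁻¹ = (μ z)⁻¹ := InverseSemigroup.map_inv μ.toMulHom z

/-- A refinement transported along an equivalence of extensions. -/
def comap (hi : ∀ a, μ (E.i a) = E'.i a) (hj : ∀ z, E'.j (μ z) = E.j z) (R : E'.Refinement S) :
    E.Refinement S where
  π := R.π.comp μ.toMulHom
  κ := R.κ
  isExtension :=
    { injective := E.injective
      surjective := R.isExtension.surjective.comp μ.surjective
      separating := fun e f he hf h => μ.injective (R.isExtension.separating _ _
        ((mulEquiv_idem_iff μ e).2 he) ((mulEquiv_idem_iff μ f).2 hf) h)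
      exact := fun z => by
        change _ ↔ IsIdempotentElem (R.π (μ z))
        rw [← R.isExtension.exact]
        exact exists_congr fun a => by rw [← hi, μ.injective.eq_iff] }
  surjective := R.surjective
  comp z := (R.comp (μ z)).trans (hj z)

variable {μ} (hi : ∀ a, μ (E.i a) = E'.i a) (hj : ∀ z, E'.j (μ z) = E.j z)
  {R' : E'.Refinement S} {ρ' : S → U'}

theorem IsOrderPreservingTransversal.comap (hρ : R'.IsOrderPreservingTransversal ρ') :
    (R'.comap μ hi hj).IsOrderPreservingTransversal fun s => μ.symm (ρ' s) where
  section_eq s := by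
    change R'.π (μ (μ.symm (ρ' s))) = s
    rw [μ.apply_symm_apply, hρ.section_eq]
  map_idempotent e he := (mulEquiv_idem_iff μ.symm _).2 (hρ.map_idempotent e he)
  monotone s t h := by
    obtain ⟨e, he, h'⟩ := hρ.monotone s t h
    exact ⟨μ.symm e, (mulEquiv_idem_iff μ.symm _).2 he, by rw [h', map_mul]⟩

theorem isAbstractKernel_comap (φ : G → Varsigma A) :
    (R'.comap μ hi hj).IsAbstractKernel (fun s => μ.symm (ρ' s)) φ ↔
      R'.IsAbstractKernel ρ' φ := by
  have e1 : ∀ (s : S) (a : A), μ.symm (ρ' s) = E.i a ↔ ρ' s = E'.i a := fun s a => by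
    rw [← hi, μ.symm_apply_eq]
  have e2 : ∀ (s : S) (a b : A), E.i b = μ.symm (ρ' s) * E.i a * (μ.symm (ρ' s))⁻¹ ↔
      E'.i b = ρ' s * E'.i a * (ρ' s)⁻¹ := fun s a b => by
    rw [← μ.injective.eq_iff, map_mul, map_mul, mulEquiv_map_inv, μ.apply_symm_apply, hi, hi]
  refine forall_congr' fun g => exists_congr fun θ => and_congr_left fun _ => ?_
  constructor
  · rintro ⟨hd, hr, ha⟩
    simp only [e1, e2] at hd hr ha
    exact ⟨hd, hr, ha⟩
  · rintro ⟨hd, hr, ha⟩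
    simp only [← e1, ← e2] at hd hr ha
    exact ⟨hd, hr, ha⟩

end Transport

end Refinement

end Extension

end PartialExt

theorem proposition2p5 {A : Type*} {G : Type*} {U : Type*} {U' : Type*}
    [PartialExt.InverseSemigroup A] [PartialExt.IsSemilatticeOfGroups A] [Group G]
    [PartialExt.InverseSemigroup U] [PartialExt.InverseSemigroup U']
    (E : PartialExt.Extension A U G) (E' : PartialExt.Extension A U' G)
    (hE : E.IsAdmissible) (hE' : E'.IsAdmissible) (h : E.Equivalent E') :
    ∃ ψ : G → PartialExt.Varsigma A, PartialExt.IsUnitalPartialHom ψ ∧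
      (∀ (S : Type*) [PartialExt.InverseSemigroup S] (R : E.Refinement S) (ρ : S → U),
        R.IsOrderPreservingTransversal ρ →
          ∀ φ : G → PartialExt.Varsigma A, R.IsAbstractKernel ρ φ ↔ φ = ψ) ∧
      (∀ (S' : Type*) [PartialExt.InverseSemigroup S'] (R' : E'.Refinement S') (ρ' : S' → U'),
        R'.IsOrderPreservingTransversal ρ' →
          ∀ φ : G → PartialExt.Varsigma A, R'.IsAbstractKernel ρ' φ ↔ φ = ψ) := by
  obtain ⟨S₀, _, R₀, ρ₀, hρ₀⟩ := hE
  -- One refinement fixes a reference retraction; every other choice is compared with it.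
  have hτ := hρ₀.isOrderedRetraction
  choose θ hθ using hτ.exists_isConjAction
  obtain ⟨μ, hi, hj⟩ := h
  refine ⟨fun g => PartialExt.Varsigma.mk (θ g), hτ.isUnitalPartialHom hθ, ?_, ?_⟩
  · intro S _ R ρ hρ φ
    exact hρ.isAbstractKernel_iff hτ hθ φ
  · intro S' _ R' ρ' hρ' φ
    -- Pulled back along `μ`, the refinement of `E'` becomes one of `E` with the same kernels, and
    -- the first case applies.
    rw [← PartialExt.Extension.Refinement.isAbstractKernel_comap hi hj]
    exact (hρ'.comap hi hj).isAbstractKernel_iff hτ hθ φ
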